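/- Let $M$ be a closed (compact, without boundary) smooth manifold, $\pi:T^*M\to M$ its cotangent bundle, $\lambda=p\,dq$ the Liouville form, $\omega=d\lambda=dp\wedge dq$, and $Y=p\,\partial_p$ the Liouville vector field. Write $\mathbb{T}=\mathbb{R}/\mathbb{Z}$ and $\mathbb{R}^-=(-\infty,0]$. Let $W\subset T^*M$ be a compact domain with smooth boundary which is star-shaped with respect to the zero section: $W$ contains the zero section, $(q,p)\in W$ implies $(q,rp)\in W$ for all $r\in[0,1]$, and $Y$ is transverse to $\partial W$. Let $\rho:T^*M\to[0,+\infty)$ be the associated radial variable: $\rho=0$ on the zero section and, for $p\neq 0$, $\rho(q,p)$ is the unique $r>0$ with $(q,p/r)\in\partial W$. Let $H\in C^\infty(\mathbb{T}\times T^*M)$, with Hamiltonian vector field $X_H$ defined by $\omega(X_H(t,z),\xi)=-d_zH(t,z)[\xi]$, and let $J=J(t,\cdot)$, $t\in\mathbb{T}$, be a smooth time-periodic almost complex structure on $T^*M$ which is $\omega$-compatible, i.e. $g_J(\xi,\eta)=\omega(J\xi,\eta)$ is a Riemannian structure. Let $x\in C^\infty(\mathbb{T},T^*M)$ be a 1-periodic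 orbit of $X_H$. Let $\mathscr{U}(x)$ be the set of all $u\in C^\infty(\mathbb{R}^-\times\mathbb{T},T^*M)$ such that 1. $\partial_su+J(t,u)(\partial_tu-X_H(t,u))=0$ on $\mathbb{R}^-\times\mathbb{T}$; 2. the energy $\int_{\mathbb{R}^-\times\mathbb{T}}|\partial_su|_J^2\,ds\,dt$ is finite, where $|\xi|_J^2=g_J(\xi,\xi)$; 3. $u(s,t)\to x(t)$ for $s\to-\infty$, uniformly in $t\in\mathbb{T}$; 4. $\partial_t(\pi\circ u)(0,t)=d_pH(t,u(0,t))$ for every $t\in\mathbb{T}$, where $d_pH(t,z)\in(T^*_{\pi(z)}M)^*=T_{\pi(z)}M$ is the fibrewise differential. Assume that for some $\rho_0>0$ and some $h\in C^\infty([\rho_0,+\infty))$ $$H(t,z)=h(\rho(z))\quad\text{and}\quad d\rho\circ J=\lambda\qquad\text{on } \mathbb{T}\times\rho^{-1}([\rho_0,+\infty)),$$ and that $$\inf_{r\ge\rho_0}\bigl(r\,h'(r)-h(r)\bigr)>-\infty.$$ Let $\rho_1\ge\rho_0$ be such that $x(\mathbb{T})\subset\rho^{-1}([0,\rho_1))$.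 Then the set $\rho^{-1}([0,\rho_1])$ is compact and contains the image of every $u\in\mathscr{U}(x)$. -/

import Mathlib

open Set Filter Topology MeasureTheory Bundle
open scoped Manifold ContDiff ENNReal

noncomputable section

/-! ### Differential geometry on a boundaryless real manifold

Functions, vector fields and endomorphism fields that depend on `t ∈ 𝕋 = ℝ/ℤ` are represented by
objects that depend `1`-periodically on `t ∈ ℝ`. Maps on the half-cylinder `ℝ⁻ × 𝕋` are
represented by maps on `ℝ × ℝ`, of which only the values at the points `(s, t)` with `s ≤ 0` are
used, and which are `1`-periodic in `t` there. -/

section Generic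

variable {F : Type*} [NormedAddCommGroup F] [NormedSpace ℝ F]
  {X : Type*} [TopologicalSpace X] {I : ModelWithCorners ℝ F X}
  {N : Type*} [TopologicalSpace N] [ChartedSpace X N]

/-- The coordinate representation of a one-form `θ` in the preferred chart at `z`, that is its
pull-back by the inverse of the chart (on a manifold without boundary). -/
def oneFormInChart (θ : ∀ z : N, TangentSpace I z →L[ℝ] ℝ) (z : N) (y : F) : F →L[ℝ] ℝ :=
  (θ ((extChartAt I z).symm y)).comp (mfderiv 𝓘(ℝ, F) I (extChartAt I z).symm y)

/-- The differential `dθ` of a one-form `θ`, evaluated at the point `z` on tangent vectors `ξ`, `η`.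
In the preferred chart at `z`, with `θ'` the coordinate representation of `θ` and `ξ'`, `η'` those
of the vectors, this is `(D_ξ' θ')(η') - (D_η' θ')(ξ')`. -/
def extDerivOneForm (θ : ∀ z : N, TangentSpace I z →L[ℝ] ℝ) (z : N) (ξ η : TangentSpace I z) : ℝ :=
  let ξ' : F := mfderiv I 𝓘(ℝ, F) (extChartAt I z) z ξ
  let η' : F := mfderiv I 𝓘(ℝ, F) (extChartAt I z) z η
  fderiv ℝ (oneFormInChart θ z) (extChartAt I z z) ξ' η' -
    fderiv ℝ (oneFormInChart θ z) (extChartAt I z z) η' ξ'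

/-- A function `H` on `𝕋 × N` is smooth. -/
def IsSmoothPeriodicFunction (I : ModelWithCorners ℝ F X) (H : ℝ → N → ℝ) : Prop :=
  ContMDiff (𝓘(ℝ, ℝ).prod I) 𝓘(ℝ, ℝ) ∞ (fun p : ℝ × N => H p.1 p.2) ∧
    ∀ t z, H (t + 1) z = H t z

/-- `J` is a smooth endomorphism field of `TN` that depends smoothly on `t ∈ 𝕋`. -/
def IsSmoothPeriodicEndomorphism [IsManifold I ∞ N]
    (J : ℝ → ∀ z : N, TangentSpace I z →L[ℝ] TangentSpace I z) : Prop :=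
  ContMDiff (𝓘(ℝ, ℝ).prod I) (I.prod 𝓘(ℝ, F →L[ℝ] F)) ∞
      (fun p : ℝ × N => TotalSpace.mk' (F →L[ℝ] F)
        (E := fun z : N => TangentSpace I z →L[ℝ] TangentSpace I z) p.2 (J p.1 p.2)) ∧
    ∀ t z, J (t + 1) z = J t z

/-- `J` is an almost complex structure and `g_J(ξ, η) = Ω(J ξ, η)` is a Riemannian structure. -/
def IsCompatibleWith (Ω : ∀ z : N, TangentSpace I z → TangentSpace I z → ℝ)
    (J : ∀ z : N, TangentSpace I z →L[ℝ] TangentSpace I z) : Prop :=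
  ∀ z : N, (∀ ξ, J z (J z ξ) = -ξ) ∧ (∀ ξ η, Ω z (J z ξ) η = Ω z (J z η) ξ) ∧
    ∀ ξ, ξ ≠ 0 → 0 < Ω z (J z ξ) ξ

/-- The Hamiltonian vector field of `H` at `z`: the vector `X` such that
`Ω(X, ξ) = - dH(z)[ξ]` for every tangent vector `ξ` at `z`. -/
def hamiltonianVectorField (Ω : ∀ z : N, TangentSpace I z → TangentSpace I z → ℝ)
    (H : N → ℝ) (z : N) : TangentSpace I z :=
  Classical.epsilon fun X : TangentSpace I z => ∀ ξ, Ω z X ξ = -(mfderiv I 𝓘(ℝ, ℝ) H z ξ)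

/-- `x : 𝕋 → N` is a smooth `1`-periodic orbit of the Hamiltonian vector field of `H`. -/
def IsPeriodicOrbit (Ω : ∀ z : N, TangentSpace I z → TangentSpace I z → ℝ)
    (H : ℝ → N → ℝ) (x : ℝ → N) : Prop :=
  ContMDiff 𝓘(ℝ, ℝ) I ∞ x ∧ (∀ t, x (t + 1) = x t) ∧
    ∀ t, mfderiv 𝓘(ℝ, ℝ) I x t 1 = hamiltonianVectorField Ω (H t) (x t)

/-- The universal cover `{(s, t) | s ≤ 0}` of the half-cylinder `ℝ⁻ × 𝕋`. -/
def halfPlane : Set (ℝ × ℝ) := {p | p.1 ≤ 0}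

/-- `∂ₛ u` at a point of the half-cylinder (one-sided at the boundary). -/
def dS (I : ModelWithCorners ℝ F X) (u : ℝ × ℝ → N) (p : ℝ × ℝ) : TangentSpace I (u p) :=
  mfderivWithin 𝓘(ℝ, ℝ × ℝ) I u halfPlane p ((1, 0) : ℝ × ℝ)

/-- `∂ₜ u` at a point of the half-cylinder. -/
def dT (I : ModelWithCorners ℝ F X) (u : ℝ × ℝ → N) (p : ℝ × ℝ) : TangentSpace I (u p) :=
  mfderivWithin 𝓘(ℝ, ℝ × ℝ) I u halfPlane p ((0, 1) : ℝ × ℝ)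

/-- `u` is a smooth map on the (closed) half-cylinder `ℝ⁻ × 𝕋`. -/
def IsSmoothOnHalfCylinder (I : ModelWithCorners ℝ F X) (u : ℝ × ℝ → N) : Prop :=
  ContMDiffOn 𝓘(ℝ, ℝ × ℝ) I ∞ u halfPlane ∧ ∀ s ≤ (0 : ℝ), ∀ t, u (s, t + 1) = u (s, t)

/-- The energy `E(u) = ∫_{ℝ⁻ × 𝕋} |∂ₛ u|_J² ds dt`, a number in `[0, ∞]`. -/
def floerEnergy (Ω : ∀ z : N, TangentSpace I z → TangentSpace I z → ℝ)
    (J : ℝ → ∀ z : N, TangentSpace I z →L[ℝ] TangentSpace I z) (u : ℝ × ℝ → N) : ℝ≥0∞ :=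
  ∫⁻ p in Iic (0 : ℝ) ×ˢ Ico (0 : ℝ) 1,
    ENNReal.ofReal (Ω (u p) (J p.2 (u p) (dS I u p)) (dS I u p))

/-- `u(s, t)` converges to `x(t)` for `s → -∞`, uniformly in `t ∈ 𝕋`. As `𝕋` is compact, uniform
convergence to a continuous loop depends only on the topology of `N`: it means that the graph of
`u(s, ·)` is eventually contained in every given neighbourhood of the graph of `x`. -/
def ConvergesUniformlyAtMinusInfinity (u : ℝ × ℝ → N) (x : ℝ → N) : Prop :=
  ∀ O : Set (ℝ × N), IsOpen O → (∀ t ∈ Icc (0 : ℝ) 1, (t, x t) ∈ O) →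
    ∀ᶠ s in atBot, ∀ t ∈ Icc (0 : ℝ) 1, (t, u (s, t)) ∈ O

end Generic

/-! ### The cotangent bundle -/

section Cotangent

variable {n : ℕ} {M : Type*} [TopologicalSpace M] [ChartedSpace (EuclideanSpace ℝ (Fin n)) M]

variable (n M) in
/-- The fibre `T_q^* M`. -/
abbrev CotangentFibre (q : M) : Type :=
  TangentSpace (𝓡 n) q →L[ℝ] Bundle.Trivial M ℝ q

variable [IsManifold (𝓡 n) ∞ M]

variable (n M) in
/-- The total space of the cotangent bundle `T^* M`, with its standard topology and smooth
structure; its points are the pairs `z = (q, p)`, with `q = z.proj` and `p = z.snd`. -/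
abbrev CotangentBundle : Type _ :=
  TotalSpace (EuclideanSpace ℝ (Fin n) →L[ℝ] ℝ) (CotangentFibre n M)

/-- The model `ℝⁿ × (ℝⁿ)^*` of `T^* M`. -/
abbrev cotangentModel (n : ℕ) :=
  (𝓡 n).prod 𝓘(ℝ, EuclideanSpace ℝ (Fin n) →L[ℝ] ℝ)

/-- The Liouville form `λ = p dq`, that is `λ(q, p)[ξ] = ⟨p, Dπ(q, p)[ξ]⟩`. -/
def liouvilleForm (z : CotangentBundle n M) : TangentSpace (cotangentModel n) z →L[ℝ] ℝ :=
  (z.snd : TangentSpace (𝓡 n) z.proj →L[ℝ] ℝ).comp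
    (mfderiv (cotangentModel n) (𝓡 n) (fun w : CotangentBundle n M => w.proj) z)

/-- The symplectic form `ω = dλ`. -/
def symplecticForm (z : CotangentBundle n M) (ξ η : TangentSpace (cotangentModel n) z) : ℝ :=
  extDerivOneForm (I := cotangentModel n) (N := CotangentBundle n M) liouvilleForm z ξ η

/-- Fibrewise multiplication `r • (q, p) = (q, r p)`. For `r = e^τ` it is the flow at time `τ` of
the Liouville vector field `Y = p ∂_p`. -/
def fibreScale (r : ℝ) (z : CotangentBundle n M) : CotangentBundle n M :=
  ⟨z.proj, r • z.snd⟩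

/-- The fibrewise differential `d_p H(q, p)`, an element of `(T_q^* M)^* = T_q M`, evaluated on the
covector `η ∈ T_q^* M`. -/
def fibreDeriv (H : CotangentBundle n M → ℝ) (z : CotangentBundle n M)
    (η : CotangentFibre n M z.proj) : ℝ :=
  deriv (fun ε : ℝ => H ⟨z.proj, z.snd + ε • η⟩) 0

/-- The intersection of `W ⊆ T^* M` with the fibre `T_q^* M`. -/
def fibreOf (W : Set (CotangentBundle n M)) (q : M) : Set (CotangentFibre n M q) :=
  {p | (⟨q, p⟩ : CotangentBundle n M) ∈ W}

/-- `W ⊆ T^* M` is a compact domain with smooth boundary, star-shaped with respect to the zero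
section: `W` contains the zero section, each of its fibres is star-shaped with respect to the
origin, and near each boundary point `W` is the sublevel `{f ≤ 0}` of a smooth function `f` which
vanishes there and has `df ≠ 0`; the Liouville vector field `Y` is transverse to the boundary
of `W`, that is `df[Y] ≠ 0`. -/
structure IsStarShapedDomain (W : Set (CotangentBundle n M)) : Prop where
  isCompact : IsCompact W
  zero_mem : ∀ q : M, (⟨q, 0⟩ : CotangentBundle n M) ∈ W
  starConvex : ∀ q : M, StarConvex ℝ 0 (fibreOf W q)
  boundary : ∀ z ∈ frontier W, ∃ f : CotangentBundle n M → ℝ,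
    ContMDiffAt (cotangentModel n) 𝓘(ℝ, ℝ) ∞ f z ∧ (∀ᶠ w in 𝓝 z, w ∈ W ↔ f w ≤ 0) ∧
      f z = 0 ∧ mfderiv (cotangentModel n) 𝓘(ℝ, ℝ) f z ≠ 0 ∧
      deriv (fun τ : ℝ => f (fibreScale (Real.exp τ) z)) 0 ≠ 0

/-- The radial variable `ρ` of `W`: `ρ(q, p)` is the `r > 0` such that `(q, p / r) ∈ ∂W` when
`p ≠ 0`, and `0` on the zero section. It is the gauge of the fibres of `W`. -/
def radialVariable (W : Set (CotangentBundle n M)) (z : CotangentBundle n M) : ℝ :=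
  gauge (fibreOf W z.proj) z.snd

/-- `H(t, z) = h(ρ(z))` on `𝕋 × ρ⁻¹([ρ₀, ∞))`, with `h` smooth on `[ρ₀, ∞)`. -/
def IsRadialOutside (W : Set (CotangentBundle n M)) (H : ℝ → CotangentBundle n M → ℝ)
    (ρ₀ : ℝ) (h : ℝ → ℝ) : Prop :=
  ContDiffOn ℝ ∞ h (Ici ρ₀) ∧
    ∀ t z, ρ₀ ≤ radialVariable W z → H t z = h (radialVariable W z)

/-- `dρ ∘ J = λ` on `𝕋 × ρ⁻¹([ρ₀, ∞))`. -/
def IsContactTypeOutside (W : Set (CotangentBundle n M))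
    (J : ℝ → ∀ z : CotangentBundle n M,
      TangentSpace (cotangentModel n) z →L[ℝ] TangentSpace (cotangentModel n) z)
    (ρ₀ : ℝ) : Prop :=
  ∀ t z, ρ₀ ≤ radialVariable W z → ∀ ξ : TangentSpace (cotangentModel n) z,
    mfderiv (cotangentModel n) 𝓘(ℝ, ℝ) (radialVariable W) z (J t z ξ) = liouvilleForm z ξ

/-- The reduced unstable manifold `𝒰(x)`: the smooth maps `u` on the half-cylinder that
(i) solve `∂ₛ u + J(t, u) (∂ₜ u - X_H(t, u)) = 0`, (ii) have finite energy, (iii) converge to `x`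
for `s → -∞`, uniformly in `t`, and (iv) satisfy `∂ₜ (π ∘ u)(0, t) = d_p H(t, u(0, t))`. -/
def reducedUnstableManifold (H : ℝ → CotangentBundle n M → ℝ)
    (J : ℝ → ∀ z : CotangentBundle n M,
      TangentSpace (cotangentModel n) z →L[ℝ] TangentSpace (cotangentModel n) z)
    (x : ℝ → CotangentBundle n M) : Set (ℝ × ℝ → CotangentBundle n M) :=
  {u | IsSmoothOnHalfCylinder (cotangentModel n) u ∧
    (∀ p ∈ halfPlane, dS (cotangentModel n) u p + J p.2 (u p) (dT (cotangentModel n) u p -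
      hamiltonianVectorField symplecticForm (H p.2) (u p)) = 0) ∧
    floerEnergy symplecticForm J u < ⊤ ∧
    ConvergesUniformlyAtMinusInfinity u x ∧
    ∀ t, ∀ η : TangentSpace (𝓡 n) (u (0, t)).proj →L[ℝ] ℝ,
      η (mfderiv 𝓘(ℝ, ℝ) (𝓡 n) (fun τ : ℝ => (u (0, τ)).proj) t 1) =
        fibreDeriv (H t) (u (0, t)) η}

end Cotangent

end

noncomputable section

/-! ### A maximum principle on the half-cylinder with Neumann boundary condition -/

/-! The proof is a maximum principle for `v = ρ ∘ u`, with a Neumann condition at `s = 0`.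

Where `v > ρ₀`, the Floer equation, `dρ ∘ J = λ`, `λ(X_H) = ρ h'(ρ)` and `dρ(X_H) = 0` give `∂ₛ v =
-λ(∂ₜ u) + v h'(v)` and `∂ₜ v = λ(∂ₛ u)` (`floer_radial`). Differentiating once more and using
`d(u^*λ) = u^*ω` (`pullback_liouvilleForm`) gives `Δ v = -ω(∂ₛ u, ∂ₜ u) + ∂ₛ(v h'(v))`. Since `ω(∂ₛ
u, ∂ₜ u) = -|∂ₛ u|² + h'(v) ∂ₛ v`, the terms `h'(v) ∂ₛ v` cancel and `Δ v = |∂ₛ u|² + v h''(v) ∂ₛ v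
≥ v h''(v) ∂ₛ v` (`laplacian_radialVariable_floer`).

At `s = 0`, pairing the boundary condition with `p` gives `λ(∂ₜ u) = d_p H[p]`, which is `v h'(v)`
by homogeneity of `ρ`. Hence `∂ₛ v = 0` there. For `s → -∞` the map is close to `x`, so `v < ρ₁`,
and `le_of_neumann_maximum_principle` concludes.

Transversality of `Y` to `∂W` supplies what is needed about `ρ`: continuity, compact sublevels, and
differentiability off the zero section by the implicit function theorem. No second derivative of `ρ`
is needed, since the formulas for `∂ₛ v` and `∂ₜ v` contain only `λ`, `u`, `h'` and `v` itself. -/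

theorem deriv_deriv_nonpos_of_isLocalMax {f : ℝ → ℝ} {x : ℝ} (h : IsLocalMax f x)
    (hc : ContinuousAt f x) : deriv (deriv f) x ≤ 0 := by
  by_contra! hpos
  have hmin := isLocalMin_of_deriv_deriv_pos hpos h.deriv_eq_zero hc
  -- A point that is both a local maximum and a local minimum has a neighbourhood on which `f` is
  -- constant, which forces `f'' = 0`.
  have hconst : f =ᶠ[𝓝 x] fun _ => f x := by
    filter_upwards [h, hmin] with y h1 h2 using le_antisymm h1 h2
  have h2 : deriv (deriv f) x = 0 := by
    rw [hconst.deriv.deriv_eq]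
    simp
  exact hpos.ne' h2

theorem HasDerivWithinAt.nonneg_of_forall_le {f : ℝ → ℝ} {f' a b : ℝ} (hab : a < b)
    (hf : HasDerivWithinAt f f' (Iic b) b) (hmax : ∀ s ∈ Icc a b, f s ≤ f b) : 0 ≤ f' := by
  have h := (hasDerivWithinAt_iff_tendsto_slope' (s := Iio b) (by simp)).1
    (hf.mono Iio_subset_Iic_self)
  refine ge_of_tendsto h ?_
  filter_upwards [Ioo_mem_nhdsLT hab] with s hs
  rw [slope_def_field]
  exact div_nonneg_of_nonpos (by linarith [hmax s ⟨hs.1.le, hs.2.le⟩]) (by linarith [hs.2])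

theorem halfPlane_mem_nhds {s : ℝ} (hs : s < 0) (t : ℝ) : halfPlane ∈ 𝓝 (s, t) :=
  mem_of_superset ((isOpen_Iio.preimage continuous_fst).mem_nhds (show (s, t).1 ∈ Iio 0 from hs))
    fun p (hp : p.1 < 0) => hp.le

/-- Let `v` be a function on the half-cylinder which satisfies `Δ v ≥ β(v) ∂ₛ v` where `v > c`, as
well as the Neumann condition `∂ₛ v = 0` at the boundary points where `v > c`. If `v < c` near the
end of the cylinder, then `v ≤ c`. -/
theorem le_of_neumann_maximum_principle {v : ℝ × ℝ → ℝ} {c : ℝ} {β : ℝ → ℝ}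
    (hv : ContinuousOn v halfPlane) (hper : ∀ s ≤ 0, ∀ t, v (s, t + 1) = v (s, t))
    (hfar : ∀ᶠ s in atBot, ∀ t ∈ Icc (0 : ℝ) 1, v (s, t) < c)
    (hβ : ContinuousOn β (Ici c))
    (hbd : ∀ t, c < v (0, t) → HasDerivWithinAt (fun s => v (s, t)) 0 (Iic 0) 0)
    (hds : ∀ s < 0, ∀ t, c < v (s, t) → DifferentiableAt ℝ (fun σ => v (σ, t)) s)
    (hdds : ∀ s < 0, ∀ t, c < v (s, t) → DifferentiableAt ℝ (deriv fun σ => v (σ, t)) s)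
    (hlap : ∀ s < 0, ∀ t, c < v (s, t) → β (v (s, t)) * deriv (fun σ => v (σ, t)) s ≤
      deriv (deriv fun σ => v (σ, t)) s + deriv (deriv fun τ => v (s, τ)) t) :
    ∀ s ≤ 0, ∀ t, v (s, t) ≤ c := by
  have hfract : ∀ s ≤ 0, ∀ t, ∃ t' ∈ Ico (0 : ℝ) 1, v (s, t) = v (s, t') := fun s hs t =>
    Function.Periodic.exists_mem_Ico₀ (f := fun t => v (s, t)) (hper s hs) one_pos t
  by_contra! hcon
  obtain ⟨s₀, hs₀, t₀', ht₀'⟩ := hcon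
  obtain ⟨t₀, ht₀, hvt₀⟩ := hfract s₀ hs₀ t₀'
  rw [hvt₀] at ht₀'
  obtain ⟨S, hS⟩ := eventually_atBot.1 hfar
  have hSs₀ : S < s₀ := by
    by_contra! hle
    exact absurd (hS s₀ hle t₀ ⟨ht₀.1, ht₀.2.le⟩) (not_lt.2 ht₀'.le)
  have hcomp : IsCompact (Icc S 0 ×ˢ Icc (0 : ℝ) 1) := isCompact_Icc.prod isCompact_Icc
  have hsub : Icc S 0 ×ˢ Icc (0 : ℝ) 1 ⊆ halfPlane := fun p hp => hp.1.2
  have hp₀ : (s₀, t₀) ∈ Icc S 0 ×ˢ Icc (0 : ℝ) 1 := ⟨⟨hSs₀.le, hs₀⟩, ht₀.1, ht₀.2.le⟩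
  -- On the compact rectangle the values of `v` above `c` lie in `[c, m]`, where `|β| ≤ B`.
  obtain ⟨m, hm⟩ := hcomp.bddAbove_image (hv.mono hsub)
  obtain ⟨B, hB⟩ := isCompact_Icc.exists_bound_of_continuousOn
    (hβ.mono (Icc_subset_Ici_self : Icc c m ⊆ Ici c))
  have hcm : c ≤ m := ht₀'.le.trans (hm (mem_image_of_mem v hp₀))
  have hB0 : 0 ≤ B := (norm_nonneg _).trans (hB c ⟨le_rfl, hcm⟩)
  -- `K > |β|` makes `ε e^{-Ks}` a strict perturbation: it decreases in `s`, and its second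
  -- derivative dominates the drift term. The choice of `ε` keeps it below half of the excess `v(s₀,
  -- t₀) - c` for `s ≥ S`.
  set K := B + 1 with hK
  have hKpos : 0 < K := by linarith
  set ε := (v (s₀, t₀) - c) / (2 * Real.exp (-K * S)) with hε
  have hεpos : 0 < ε := div_pos (by linarith) (by positivity)
  have hεexp : ∀ s, S ≤ s → ε * Real.exp (-K * s) ≤ (v (s₀, t₀) - c) / 2 := by
    intro s hs
    have h1 : Real.exp (-K * s) ≤ Real.exp (-K * S) := Real.exp_le_exp.2 (by nlinarith)
    calc ε * Real.exp (-K * s) ≤ ε * Real.exp (-K * S) := by gcongr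
      _ = (v (s₀, t₀) - c) / 2 := by rw [hε]; field_simp
  set w : ℝ × ℝ → ℝ := fun p => v p + ε * Real.exp (-K * p.1) with hw
  have hwc : ContinuousOn w halfPlane := hv.add (by fun_prop)
  obtain ⟨⟨s, t⟩, hst, hmax⟩ := hcomp.exists_isMaxOn ⟨_, hp₀⟩ (hwc.mono hsub)
  -- By periodicity the maximum is over all `τ`, so `t` is an interior maximum even if it is `0` or
  -- `1`.
  have hmax' : ∀ σ ∈ Icc S 0, ∀ τ, w (σ, τ) ≤ w (s, t) := by
    intro σ hσ τ
    obtain ⟨τ', hτ', hvτ⟩ := hfract σ hσ.2 τ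
    have : w (σ, τ) = w (σ, τ') := by simp only [hw, hvτ]
    rw [this]
    exact hmax (show (σ, τ') ∈ Icc S 0 ×ˢ Icc (0 : ℝ) 1 from ⟨hσ, hτ'.1, hτ'.2.le⟩)
  have hvc : c < v (s, t) := by
    have h1 : w (s₀, t₀) ≤ w (s, t) := hmax hp₀
    have h2 := hεexp s hst.1.1
    have h3 : 0 < ε * Real.exp (-K * s₀) := by positivity
    simp only [hw] at h1
    linarith
  have hSs : S < s := by
    by_contra! hle
    exact absurd (hS s hle t hst.2) (not_lt.2 hvc.le)
  have hexp : ∀ σ, HasDerivAt (fun σ => ε * Real.exp (-K * σ)) (-(ε * K * Real.exp (-K * σ))) σ := by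
    intro σ
    exact (((hasDerivAt_id' σ).const_mul (-K)).exp.const_mul ε).congr_deriv (by ring)
  rcases (show s ≤ 0 from hst.1.2).eq_or_lt with rfl | hs
  -- Maximum on the boundary: the Neumann condition leaves `∂ₛ w = -ε K < 0`, while a maximum at the
  -- right end requires `∂ₛ w ≥ 0`.
  · have h1 : HasDerivWithinAt (fun σ => w (σ, t)) (0 + -(ε * K * Real.exp (-K * 0))) (Iic 0) 0 :=
      (hbd t hvc).add (hexp 0).hasDerivWithinAt
    have h2 := h1.nonneg_of_forall_le hSs fun σ hσ => hmax' σ hσ t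
    have h3 : 0 < ε * K * Real.exp (-K * 0) := by positivity
    linarith
  -- Interior maximum: `∂ₛ w = 0` gives `∂ₛ v = ε K e^{-Ks}`, so `Δ w ≥ ε K e^{-Ks} (β + K) > 0`,
  -- against `Δ w ≤ 0`.
  · have hvat : ContinuousAt v (s, t) := hv.continuousAt (halfPlane_mem_nhds hs t)
    have hwat : ContinuousAt w (s, t) := hwc.continuousAt (halfPlane_mem_nhds hs t)
    have hwS : ContinuousAt (fun σ => w (σ, t)) s :=
      ContinuousAt.comp (f := fun σ : ℝ => (σ, t)) hwat (by fun_prop)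
    have hwT : ContinuousAt (fun τ => w (s, τ)) t :=
      ContinuousAt.comp (f := fun τ : ℝ => (s, τ)) hwat (by fun_prop)
    have hvS : ContinuousAt (fun σ => v (σ, t)) s :=
      ContinuousAt.comp (f := fun σ : ℝ => (σ, t)) hvat (by fun_prop)
    have hlocS : IsLocalMax (fun σ => w (σ, t)) s := by
      filter_upwards [Ioo_mem_nhds hSs hs] with σ hσ using hmax' σ ⟨hσ.1.le, hσ.2.le⟩ t
    have hlocT : IsLocalMax (fun τ => w (s, τ)) t :=
      Eventually.of_forall fun τ => hmax' s ⟨hSs.le, hs.le⟩ τ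
    have hderiv : deriv (fun σ => w (σ, t)) =ᶠ[𝓝 s]
        fun σ => deriv (fun σ => v (σ, t)) σ + -(ε * K * Real.exp (-K * σ)) := by
      filter_upwards [hvS.eventually (lt_mem_nhds hvc), gt_mem_nhds hs] with σ h1 h2
      exact ((hds σ h2 t h1).hasDerivAt.add (hexp σ)).deriv
    have hss : deriv (deriv fun σ => w (σ, t)) s =
        deriv (deriv fun σ => v (σ, t)) s + ε * K * K * Real.exp (-K * s) := by
      rw [hderiv.deriv_eq]
      refine ((hdds s hs t hvc).hasDerivAt.add (f := fun σ => deriv (fun σ => v (σ, t)) σ)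
        ((((hasDerivAt_id' s).const_mul (-K)).exp.const_mul (ε * K)).neg :
          HasDerivAt (fun σ => -(ε * K * Real.exp (-K * σ))) _ s)).deriv.trans ?_
      ring
    have htt : deriv (deriv fun τ => w (s, τ)) t = deriv (deriv fun τ => v (s, τ)) t := by
      congr 1
      ext τ
      exact deriv_add_const (f := fun τ => v (s, τ)) (ε * Real.exp (-K * s))
    have h1 := deriv_deriv_nonpos_of_isLocalMax hlocS hwS
    have h2 := deriv_deriv_nonpos_of_isLocalMax hlocT hwT
    have h3 := hderiv.self_of_nhds.symm.trans hlocS.deriv_eq_zero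
    have h4 := hlap s hs t hvc
    have h5 : |β (v (s, t))| ≤ B := hB _ ⟨hvc.le, hm (mem_image_of_mem v hst)⟩
    have h6 : deriv (fun σ => v (σ, t)) s = ε * K * Real.exp (-K * s) := by linarith
    rw [hss] at h1
    rw [htt] at h2
    rw [h6] at h4
    have h7 : 0 < ε * K * Real.exp (-K * s) := by positivity
    have h8 := (abs_le.1 h5).1
    nlinarith

/-! ### Canonical coordinates on `T^* M`: the forms `λ` and `ω` -/

section Charts

variable {n : ℕ} {M : Type*} [TopologicalSpace M] [ChartedSpace (EuclideanSpace ℝ (Fin n)) M]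
  [IsManifold (𝓡 n) ∞ M]

variable (n) in
/-- The model space `ℝⁿ × (ℝⁿ)^*` of `T^* M`. -/
abbrev CotangentSpace : Type :=
  EuclideanSpace ℝ (Fin n) × (EuclideanSpace ℝ (Fin n) →L[ℝ] ℝ)

/-- The preferred chart of `T^* M` at `z₀`. -/
abbrev cotangentChart (z₀ : CotangentBundle n M) :=
  extChartAt (cotangentModel n) z₀

theorem cotangentChart_apply (z₀ w : CotangentBundle n M) :
    cotangentChart z₀ w = (extChartAt (𝓡 n) z₀.proj w.proj,
      (w.snd : TangentSpace (𝓡 n) w.proj →L[ℝ] ℝ).comp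
        ((trivializationAt (EuclideanSpace ℝ (Fin n)) (TangentSpace (𝓡 n)) z₀.proj).symmL ℝ
          w.proj)) := by
  have h : cotangentChart z₀ w = chartAt (ModelProd (EuclideanSpace ℝ (Fin n))
    (EuclideanSpace ℝ (Fin n) →L[ℝ] ℝ)) z₀ w := rfl
  rw [h, hom_chart]
  simp only [ContinuousLinearMap.inCoordinates, extChartAt, mfld_simps]
  congr 1
  ext v
  simp

theorem cotangentChart_source (z₀ : CotangentBundle n M) :
    (cotangentChart z₀).source =
      {w | w.proj ∈ (chartAt (EuclideanSpace ℝ (Fin n)) z₀.proj).source} := by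
  rw [extChartAt_source, FiberBundle.chartedSpace_chartAt]
  ext w
  simp only [OpenPartialHomeomorph.trans_source, OpenPartialHomeomorph.prod_source,
    OpenPartialHomeomorph.refl_source, mem_inter_iff, mem_preimage, mem_prod, mem_univ, and_true,
    Trivialization.coe_coe, mem_ofPred_eq, hom_trivializationAt_source]
  simp +contextual

/-- The derivative at `z` of the preferred chart at `z₀`. -/
def chartDeriv (z₀ z : CotangentBundle n M) :
    TangentSpace (cotangentModel n) z →L[ℝ] CotangentSpace n :=
  mfderiv (cotangentModel n) 𝓘(ℝ, CotangentSpace n) (cotangentChart z₀) z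

theorem hasMFDerivAt_cotangentChart {z₀ z : CotangentBundle n M}
    (hz : z ∈ (cotangentChart z₀).source) :
    HasMFDerivAt (cotangentModel n) 𝓘(ℝ, CotangentSpace n) (cotangentChart z₀) z
      (chartDeriv z₀ z) :=
  (mdifferentiableAt_extChartAt (by rwa [extChartAt_source] at hz)).hasMFDerivAt

/-- The base component of the chart is the base chart composed with `π`, and the trivialization that
defines the `p`-coordinate inverts the derivative of the base chart. The chart centre `z₀` may
differ from `z`, as is needed to differentiate in `z`. -/
theorem liouvilleForm_apply_eq_chart {z₀ z : CotangentBundle n M}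
    (hz : z ∈ (cotangentChart z₀).source) (ξ : TangentSpace (cotangentModel n) z) :
    liouvilleForm z ξ = (cotangentChart z₀ z).2 (chartDeriv z₀ z ξ).1 := by
  have hz' : z.proj ∈ (chartAt (EuclideanSpace ℝ (Fin n)) z₀.proj).source := by
    rwa [cotangentChart_source] at hz
  have hproj : MDifferentiableAt (cotangentModel n) (𝓡 n)
      (fun w : CotangentBundle n M => w.proj) z :=
    (contMDiffAt_proj (n := 1) _).mdifferentiableAt one_ne_zero
  have hbase : MDifferentiableAt (𝓡 n) 𝓘(ℝ, EuclideanSpace ℝ (Fin n))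
      (extChartAt (𝓡 n) z₀.proj) z.proj := mdifferentiableAt_extChartAt hz'
  have h1 := (ContinuousLinearMap.fst ℝ (EuclideanSpace ℝ (Fin n))
    (EuclideanSpace ℝ (Fin n) →L[ℝ] ℝ)).hasMFDerivAt.comp z (hasMFDerivAt_cotangentChart hz)
  have h2 := hbase.hasMFDerivAt.comp z hproj.hasMFDerivAt
  have h3 : ContinuousLinearMap.fst ℝ (EuclideanSpace ℝ (Fin n))
      (EuclideanSpace ℝ (Fin n) →L[ℝ] ℝ) ∘ cotangentChart z₀ =
      extChartAt (𝓡 n) z₀.proj ∘ fun w : CotangentBundle n M => w.proj := by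
    ext1 w
    exact congrArg Prod.fst (cotangentChart_apply z₀ w)
  rw [h3] at h1
  have h4 : (chartDeriv z₀ z ξ).1 = mfderiv (𝓡 n) 𝓘(ℝ, EuclideanSpace ℝ (Fin n))
      (extChartAt (𝓡 n) z₀.proj) z.proj
      (mfderiv (cotangentModel n) (𝓡 n) (fun w : CotangentBundle n M => w.proj) z ξ) :=
    DFunLike.congr_fun (hasMFDerivAt_unique h1 h2) ξ
  rw [h4, ← TangentBundle.continuousLinearMapAt_trivializationAt hz', cotangentChart_apply,
    liouvilleForm, ContinuousLinearMap.comp_apply]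
  have h5 := (trivializationAt (EuclideanSpace ℝ (Fin n)) (TangentSpace (𝓡 n) (M := M))
    z₀.proj).symmL_continuousLinearMapAt (R := ℝ) (b := z.proj) (by simpa using! hz')
    (mfderiv (cotangentModel n) (𝓡 n) (fun w : CotangentBundle n M => w.proj) z ξ)
  exact congrArg (fun X => (z.snd : TangentSpace (𝓡 n) z.proj →L[ℝ] ℝ) X) h5.symm

theorem chartDeriv_symm_apply (z₀ : CotangentBundle n M) {y : CotangentSpace n}
    (hy : y ∈ (cotangentChart z₀).target) (ξ : CotangentSpace n) :
    chartDeriv z₀ ((cotangentChart z₀).symm y)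
      (mfderiv 𝓘(ℝ, CotangentSpace n) (cotangentModel n) (cotangentChart z₀).symm y ξ) = ξ := by
  have h := mfderiv_extChartAt_comp_mfderivWithin_extChartAt_symm (I := cotangentModel n) hy
  rw [ModelWithCorners.range_eq_univ, mfderivWithin_univ] at h
  exact DFunLike.congr_fun h ξ

theorem oneFormInChart_liouvilleForm (z₀ : CotangentBundle n M) {y : CotangentSpace n}
    (hy : y ∈ (cotangentChart z₀).target) (ξ : CotangentSpace n) :
    oneFormInChart (I := cotangentModel n) liouvilleForm z₀ y ξ = y.2 ξ.1 := by
  have h := liouvilleForm_apply_eq_chart ((cotangentChart z₀).map_target hy)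
    (mfderiv 𝓘(ℝ, CotangentSpace n) (cotangentModel n) (cotangentChart z₀).symm y ξ)
  rw [chartDeriv_symm_apply z₀ hy, (cotangentChart z₀).right_inv hy] at h
  exact h

variable (n) in
/-- The one-form `p dq` in coordinates. -/
def coordinateLiouvilleForm : CotangentSpace n →L[ℝ] CotangentSpace n →L[ℝ] ℝ :=
  ((ContinuousLinearMap.compL ℝ (CotangentSpace n) (EuclideanSpace ℝ (Fin n)) ℝ).flip
    (ContinuousLinearMap.fst ℝ _ _)).comp (ContinuousLinearMap.snd ℝ _ _)

/-- Near the centre of the chart the coordinate form `p dq` is a continuous linear function of the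
point, hence equals its own derivative. -/
theorem symplecticForm_apply_eq_chart (z : CotangentBundle n M)
    (ξ η : TangentSpace (cotangentModel n) z) :
    symplecticForm z ξ η =
      (chartDeriv z z ξ).2 (chartDeriv z z η).1 - (chartDeriv z z η).2 (chartDeriv z z ξ).1 := by
  have h : oneFormInChart (I := cotangentModel n) (liouvilleForm (M := M)) z
      =ᶠ[𝓝 (cotangentChart z z)] coordinateLiouvilleForm n := by
    filter_upwards [extChartAt_target_mem_nhds z] with y hy
    exact ContinuousLinearMap.ext fun ξ => oneFormInChart_liouvilleForm z hy ξ
  have h2 := h.fderiv_eq.trans (ContinuousLinearMap.fderiv _)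
  rw [symplecticForm, extDerivOneForm, h2]
  rfl

/-- The Liouville vector field `Y = p ∂_p`. -/
def liouvilleVectorField (z : CotangentBundle n M) : TangentSpace (cotangentModel n) z :=
  (chartDeriv z z).inverse (0, (cotangentChart z z).2)

theorem isInvertible_chartDeriv {z₀ z : CotangentBundle n M}
    (hz : z ∈ (cotangentChart z₀).source) : (chartDeriv z₀ z).IsInvertible :=
  isInvertible_mfderiv_extChartAt hz

theorem chartDeriv_liouvilleVectorField (z : CotangentBundle n M) :
    chartDeriv z z (liouvilleVectorField z) = (0, (cotangentChart z z).2) :=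
  (isInvertible_chartDeriv (mem_extChartAt_source z)).self_apply_inverse _

theorem symplecticForm_liouvilleVectorField (z : CotangentBundle n M)
    (ξ : TangentSpace (cotangentModel n) z) :
    symplecticForm z (liouvilleVectorField z) ξ = liouvilleForm z ξ := by
  rw [symplecticForm_apply_eq_chart, chartDeriv_liouvilleVectorField,
    liouvilleForm_apply_eq_chart (mem_extChartAt_source z)]
  simp

theorem symplecticForm_swap (z : CotangentBundle n M) (ξ η : TangentSpace (cotangentModel n) z) :
    symplecticForm z ξ η = -symplecticForm z η ξ := by
  simp only [symplecticForm_apply_eq_chart, neg_sub]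

theorem symplecticForm_add_left (z : CotangentBundle n M)
    (ξ ξ' η : TangentSpace (cotangentModel n) z) :
    symplecticForm z (ξ + ξ') η = symplecticForm z ξ η + symplecticForm z ξ' η := by
  have h : chartDeriv z z (ξ + ξ') = chartDeriv z z ξ + chartDeriv z z ξ' :=
    (chartDeriv z z).map_add ξ ξ'
  simp only [symplecticForm_apply_eq_chart, h, Prod.fst_add, Prod.snd_add, map_add, add_apply]
  ring

theorem symplecticForm_add_right (z : CotangentBundle n M)
    (ξ η η' : TangentSpace (cotangentModel n) z) :
    symplecticForm z ξ (η + η') = symplecticForm z ξ η + symplecticForm z ξ η' := by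
  rw [symplecticForm_swap, symplecticForm_add_left, symplecticForm_swap z η, 
    symplecticForm_swap z η']
  ring

/-- Nondegeneracy of the symplectic form: every linear form on a tangent space is of the form
`ω(X, ·)`. -/
theorem exists_symplecticForm_eq (z : CotangentBundle n M)
    (α : TangentSpace (cotangentModel n) z →L[ℝ] ℝ) : 
    ∃ X : TangentSpace (cotangentModel n) z, ∀ ξ, symplecticForm z X ξ = α ξ := by
  have hinv := isInvertible_chartDeriv (mem_extChartAt_source (I := cotangentModel n) z)
  set α' : CotangentSpace n →L[ℝ] ℝ := α.comp (chartDeriv z z).inverse with hα'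
  -- The base component of `X` comes from reflexivity of `ℝⁿ`, applied to minus the restriction of
  -- `α` to momentum directions.
  obtain ⟨X₁, hX₁⟩ := (Module.evalEquiv ℝ (EuclideanSpace ℝ (Fin n))).surjective
    ((-(α'.comp (ContinuousLinearMap.inr ℝ _ _))).toLinearMap.comp
      (LinearMap.toContinuousLinearMap (𝕜 := ℝ)).toLinearMap)
  refine ⟨(chartDeriv z z).inverse (X₁, α'.comp (ContinuousLinearMap.inl ℝ _ _)), fun ξ => ?_⟩
  rw [symplecticForm_apply_eq_chart, hinv.self_apply_inverse]
  have h1 : (chartDeriv z z ξ).2 X₁ = -α' (0, (chartDeriv z z ξ).2) := by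
    have := DFunLike.congr_fun hX₁ (chartDeriv z z ξ).2.toLinearMap
    simpa using! this
  have h2 : α ξ = α' (chartDeriv z z ξ) := by
    rw [hα', ContinuousLinearMap.comp_apply, hinv.inverse_apply_self]
  rw [h1, h2, ← Prod.fst_add_snd (chartDeriv z z ξ), map_add]
  simp

/-- Nondegeneracy provides a vector with the defining property, so the choice by `Classical.epsilon`
has it. -/
theorem symplecticForm_hamiltonianVectorField (H : CotangentBundle n M → ℝ)
    (z : CotangentBundle n M) (ξ : TangentSpace (cotangentModel n) z) :
    symplecticForm z (hamiltonianVectorField symplecticForm H z) ξ =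
      -(mfderiv (cotangentModel n) 𝓘(ℝ, ℝ) H z ξ) :=
  Classical.epsilon_spec (exists_symplecticForm_eq z
    (-(mfderiv (cotangentModel n) 𝓘(ℝ, ℝ) H z))) ξ

/-- The differential at `z` of a function on `T^* M`, as a linear form. -/
def differentialAt (F : CotangentBundle n M → ℝ) (z : CotangentBundle n M) :
    TangentSpace (cotangentModel n) z →L[ℝ] ℝ :=
  mfderiv (cotangentModel n) 𝓘(ℝ, ℝ) F z

theorem symplecticForm_hamiltonianVectorField_left (H : CotangentBundle n M → ℝ)
    (z : CotangentBundle n M) (ξ : TangentSpace (cotangentModel n) z) :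
    symplecticForm z (hamiltonianVectorField symplecticForm H z) ξ = -differentialAt H z ξ :=
  symplecticForm_hamiltonianVectorField H z ξ

theorem symplecticForm_self (z : CotangentBundle n M) (ξ : TangentSpace (cotangentModel n) z) :
    symplecticForm z ξ ξ = 0 := by
  rw [symplecticForm_apply_eq_chart, sub_self]

end Charts

/-! ### The pull-back of `λ` and `ω` by a map of the plane -/

section Pullback

variable {n : ℕ} {M : Type*} [TopologicalSpace M] [ChartedSpace (EuclideanSpace ℝ (Fin n)) M]
  [IsManifold (𝓡 n) ∞ M]

theorem contDiffAt_cotangentChart_comp {u : ℝ × ℝ → CotangentBundle n M} {p : ℝ × ℝ}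
    (hu : ContMDiffAt 𝓘(ℝ, ℝ × ℝ) (cotangentModel n) ∞ u p) :
    ContDiffAt ℝ 2 (cotangentChart (u p) ∘ u) p :=
  (contMDiffAt_extChartAt.comp p (hu.of_le (WithTop.coe_le_coe.2 le_top))).contDiffAt

theorem eventually_fderiv_cotangentChart_comp {u : ℝ × ℝ → CotangentBundle n M} {p : ℝ × ℝ}
    (hu : ContMDiffAt 𝓘(ℝ, ℝ × ℝ) (cotangentModel n) ∞ u p) :
    ∀ᶠ q in 𝓝 p, u q ∈ (cotangentChart (u p)).source ∧
      ∀ e, fderiv ℝ (cotangentChart (u p) ∘ u) q e =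
        chartDeriv (u p) (u q) (mfderiv 𝓘(ℝ, ℝ × ℝ) (cotangentModel n) u q e) := by
  have h1 : ∀ᶠ q in 𝓝 p, ContMDiffAt 𝓘(ℝ, ℝ × ℝ) (cotangentModel n) 1 u q :=
    (contMDiffAt_iff_contMDiffAt_nhds (I := 𝓘(ℝ, ℝ × ℝ)) (I' := cotangentModel n) (by simp)).1
      (hu.of_le (by simp))
  filter_upwards [h1, hu.continuousAt.eventually (extChartAt_source_mem_nhds (I := cotangentModel n) (u p))] with q hq hs
  refine ⟨hs, fun e => ?_⟩
  have h := (hasMFDerivAt_cotangentChart hs).comp q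
    (hq.mdifferentiableAt one_ne_zero).hasMFDerivAt
  rw [← mfderiv_eq_fderiv]
  exact DFunLike.congr_fun h.mfderiv e

theorem hasFDerivAt_snd_apply_fderiv {G E : Type*} [NormedAddCommGroup G] [NormedSpace ℝ G]
    [NormedAddCommGroup E] [NormedSpace ℝ E] {U : G → E × (E →L[ℝ] ℝ)} {p : G}
    (hU : ContDiffAt ℝ 2 U p) (e : G) :
    ∃ L : G →L[ℝ] ℝ, HasFDerivAt (fun q => (U q).2 (fderiv ℝ U q e).1) L p ∧
      ∀ e', L e' = (U p).2 (fderiv ℝ (fderiv ℝ U) p e' e).1 +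
        (fderiv ℝ U p e').2 (fderiv ℝ U p e).1 := by
  have h1 : HasFDerivAt U (fderiv ℝ U p) p := (hU.differentiableAt (by simp)).hasFDerivAt
  have h2 := ((hU.fderiv_right (m := 1) (by norm_num)).differentiableAt one_ne_zero).hasFDerivAt
  have h3 := h1.snd.clm_apply (h2.clm_apply (hasFDerivAt_const e p)).fst
  refine ⟨_, h3, fun e' => ?_⟩
  simp

/-- The formula `d(u^* λ) = u^* ω` for a map `u` from the plane to `T^* M`. -/
theorem pullback_liouvilleForm {u : ℝ × ℝ → CotangentBundle n M} {p : ℝ × ℝ}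
    (hu : ContMDiffAt 𝓘(ℝ, ℝ × ℝ) (cotangentModel n) ∞ u p) (e e' : ℝ × ℝ) :
    ∃ L L' : ℝ × ℝ →L[ℝ] ℝ,
      HasFDerivAt (fun q => liouvilleForm (u q)
        (mfderiv 𝓘(ℝ, ℝ × ℝ) (cotangentModel n) u q e)) L p ∧
      HasFDerivAt (fun q => liouvilleForm (u q)
        (mfderiv 𝓘(ℝ, ℝ × ℝ) (cotangentModel n) u q e')) L' p ∧
      L' e - L e' = symplecticForm (u p) (mfderiv 𝓘(ℝ, ℝ × ℝ) (cotangentModel n) u p e)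
        (mfderiv 𝓘(ℝ, ℝ × ℝ) (cotangentModel n) u p e') := by
  have hU := contDiffAt_cotangentChart_comp hu
  have hev := eventually_fderiv_cotangentChart_comp hu
  have heq : ∀ e, (fun q => liouvilleForm (u q)
      (mfderiv 𝓘(ℝ, ℝ × ℝ) (cotangentModel n) u q e)) =ᶠ[𝓝 p]
      fun q => ((cotangentChart (u p) ∘ u) q).2
        (fderiv ℝ (cotangentChart (u p) ∘ u) q e).1 := by
    intro e
    filter_upwards [hev] with q hq
    rw [liouvilleForm_apply_eq_chart hq.1, hq.2 e]
    rfl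
  obtain ⟨L, hL, hL'⟩ := hasFDerivAt_snd_apply_fderiv hU e
  obtain ⟨K, hK, hK'⟩ := hasFDerivAt_snd_apply_fderiv hU e'
  refine ⟨L, K, hL.congr_of_eventuallyEq (heq e), hK.congr_of_eventuallyEq (heq e'), ?_⟩
  -- The second-order terms cancel by symmetry; the remaining products are `ω` in canonical
  -- coordinates.
  have hsymm : fderiv ℝ (fderiv ℝ (cotangentChart (u p) ∘ u)) p e e' =
      fderiv ℝ (fderiv ℝ (cotangentChart (u p) ∘ u)) p e' e :=
    (hU.isSymmSndFDerivAt (by simp)).eq e e'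
  rw [hL', hK', hsymm, symplecticForm_apply_eq_chart, ← hev.self_of_nhds.2, ← hev.self_of_nhds.2]
  ring

section HalfPlane

variable {u : ℝ × ℝ → CotangentBundle n M}

theorem dS_eq_mfderiv {p : ℝ × ℝ} (hp : p.1 < 0) :
    dS (cotangentModel n) u p = mfderiv 𝓘(ℝ, ℝ × ℝ) (cotangentModel n) u p ((1, 0) : ℝ × ℝ) := by
  rw [dS, mfderivWithin_of_mem_nhds (halfPlane_mem_nhds hp p.2)]

theorem dT_eq_mfderiv {p : ℝ × ℝ} (hp : p.1 < 0) :
    dT (cotangentModel n) u p = mfderiv 𝓘(ℝ, ℝ × ℝ) (cotangentModel n) u p ((0, 1) : ℝ × ℝ) := by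
  rw [dT, mfderivWithin_of_mem_nhds (halfPlane_mem_nhds hp p.2)]

/-- `λ(∂ₜ u)` at a boundary point is `⟨p, ∂ₜ (π ∘ u)⟩`. -/
theorem liouvilleForm_dT_boundary
    (hu : ContMDiffOn 𝓘(ℝ, ℝ × ℝ) (cotangentModel n) ∞ u halfPlane) (t : ℝ) :
    liouvilleForm (u (0, t)) (dT (cotangentModel n) u (0, t)) =
      ((u (0, t)).snd : TangentSpace (𝓡 n) (u (0, t)).proj →L[ℝ] ℝ)
        (mfderiv 𝓘(ℝ, ℝ) (𝓡 n) (fun τ : ℝ => (u (0, τ)).proj) t 1) := by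
  have hp : ((0 : ℝ), t) ∈ halfPlane := show (0 : ℝ) ≤ 0 from le_rfl
  have h1 := ((hu _ hp).mdifferentiableWithinAt (by simp)).hasMFDerivWithinAt
  have hproj : HasMFDerivAt (cotangentModel n) (𝓡 n) (fun w : CotangentBundle n M => w.proj)
      (u (0, t)) _ :=
    ((contMDiffAt_proj (n := 1) _).mdifferentiableAt one_ne_zero).hasMFDerivAt
  have h2 := hproj.comp_hasMFDerivWithinAt (0, t) h1
  -- The line `s = 0` lies in the half-plane, so the one-sided derivative of `u` restricts to it by
  -- the chain rule.
  have hline : HasFDerivAt (fun τ : ℝ => ((0 : ℝ), τ)) (ContinuousLinearMap.inr ℝ ℝ ℝ) t :=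
    (hasFDerivAt_const 0 t).prodMk (hasFDerivAt_id t)
  have h3 := h2.comp t (hline.hasMFDerivAt.hasMFDerivWithinAt (s := univ))
    (fun τ _ => show (0 : ℝ) ≤ 0 from le_rfl)
  rw [hasMFDerivWithinAt_univ] at h3
  rw [show (fun τ : ℝ => (u (0, τ)).proj) = ((fun w : CotangentBundle n M => w.proj) ∘ u) ∘
    fun τ : ℝ => ((0 : ℝ), τ) from rfl, h3.mfderiv]
  rfl

end HalfPlane

end Pullback

/-! ### The radial variable: continuity and compact sublevels -/

section Radial

variable {n : ℕ} {M : Type*} [TopologicalSpace M] [ChartedSpace (EuclideanSpace ℝ (Fin n)) M]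
  [IsManifold (𝓡 n) ∞ M]

theorem cotangentChart_fibreScale (z₀ z : CotangentBundle n M) (r : ℝ) :
    cotangentChart z₀ (fibreScale r z) =
      ((cotangentChart z₀ z).1, r • (cotangentChart z₀ z).2) := by
  rw [cotangentChart_apply, cotangentChart_apply]
  rfl

theorem fibreScale_mem_source {z₀ z : CotangentBundle n M} {r : ℝ} :
    fibreScale r z ∈ (cotangentChart z₀).source ↔ z ∈ (cotangentChart z₀).source := by
  simp only [cotangentChart_source]
  rfl

theorem cotangentChart_symm_smul {z₀ : CotangentBundle n M} {y : CotangentSpace n}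
    (hy : y ∈ (cotangentChart z₀).target) (a : ℝ) :
    (cotangentChart z₀).symm (y.1, a • y.2) = fibreScale a ((cotangentChart z₀).symm y) := by
  have hs := (cotangentChart z₀).map_target hy
  have hs' : fibreScale a ((cotangentChart z₀).symm y) ∈ (cotangentChart z₀).source :=
    fibreScale_mem_source.2 hs
  rw [← (cotangentChart z₀).left_inv hs', cotangentChart_fibreScale,
    (cotangentChart z₀).right_inv hy]

theorem fibreScale_one (z : CotangentBundle n M) : fibreScale 1 z = z := by
  simp [fibreScale]

theorem fibreScale_fibreScale (a b : ℝ) (z : CotangentBundle n M) :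
    fibreScale a (fibreScale b z) = fibreScale (a * b) z := by
  exact congrArg (TotalSpace.mk z.proj) (smul_smul a b z.snd)

theorem continuous_fibreScale :
    Continuous fun x : ℝ × CotangentBundle n M => fibreScale x.1 x.2 := by
  refine continuous_iff_continuousAt.2 fun ⟨r, z⟩ => ?_
  have hs : ∀ᶠ x : ℝ × CotangentBundle n M in 𝓝 (r, z), x.2 ∈ (cotangentChart z).source :=
    continuous_snd.continuousAt.eventually (extChartAt_source_mem_nhds z)
  have heq : (fun x : ℝ × CotangentBundle n M => fibreScale x.1 x.2) =ᶠ[𝓝 (r, z)] fun x =>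
      (cotangentChart z).symm ((cotangentChart z x.2).1, x.1 • (cotangentChart z x.2).2) := by
    filter_upwards [hs] with x hx
    rw [← cotangentChart_fibreScale, (cotangentChart z).left_inv (fibreScale_mem_source.2 hx)]
  refine ContinuousAt.congr ?_ heq.symm
  have hchart : ContinuousAt (fun x : ℝ × CotangentBundle n M => cotangentChart z x.2) (r, z) :=
    ContinuousAt.comp (f := Prod.snd) (continuousAt_extChartAt z) continuousAt_snd
  refine ContinuousAt.comp (g := (cotangentChart z).symm)
    (f := fun x : ℝ × CotangentBundle n M =>
      ((cotangentChart z x.2).1, x.1 • (cotangentChart z x.2).2)) ?_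
    (hchart.fst.prodMk (continuousAt_fst.smul hchart.snd))
  refine continuousAt_extChartAt_symm'' ?_
  rw [← cotangentChart_fibreScale]
  exact (cotangentChart z).map_source (fibreScale_mem_source.2 (mem_extChartAt_source z))

/-- Makes the compact set `W` closed. Points of one fibre are separated in a chart, whose source
contains the whole fibre. -/
instance [T2Space M] : T2Space (CotangentBundle n M) := by
  refine ⟨fun z w hzw => ?_⟩
  by_cases hproj : z.proj = w.proj
  · have hw : w ∈ (cotangentChart z).source := by
      rw [cotangentChart_source]
      simp [← hproj]
    have hne : cotangentChart z z ≠ cotangentChart z w := fun h =>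
      hzw ((cotangentChart z).injOn (mem_extChartAt_source z) hw h)
    obtain ⟨A, B, hA, hB, hzA, hwB, hAB⟩ := t2_separation hne
    refine ⟨_, _, isOpen_extChartAt_preimage z hA, isOpen_extChartAt_preimage z hB,
      ⟨by simp, hzA⟩, ⟨by rwa [extChartAt_source] at hw, hwB⟩, ?_⟩
    exact (hAB.preimage _).mono inter_subset_right inter_subset_right
  · exact separated_by_continuous (FiberBundle.continuous_proj
      (EuclideanSpace ℝ (Fin n) →L[ℝ] ℝ) (CotangentFibre n M)) hproj

theorem continuous_fibreScale_const (a : ℝ) :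
    Continuous (fibreScale a : CotangentBundle n M → CotangentBundle n M) :=
  continuous_fibreScale.comp (continuous_const.prodMk continuous_id)

theorem continuous_fibreScale_left (z : CotangentBundle n M) :
    Continuous fun a : ℝ => fibreScale a z :=
  continuous_fibreScale.comp (continuous_id.prodMk continuous_const)

theorem radialVariable_eq_sInf (W : Set (CotangentBundle n M)) (z : CotangentBundle n M) :
    radialVariable W z = sInf {r : ℝ | 0 < r ∧ fibreScale r⁻¹ z ∈ W} := by
  rw [radialVariable, gauge_def']
  rfl

variable {W : Set (CotangentBundle n M)}

theorem radialVariable_nonneg (W : Set (CotangentBundle n M)) (z : CotangentBundle n M) :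
    0 ≤ radialVariable W z := gauge_nonneg _

theorem radialVariable_fibreScale (W : Set (CotangentBundle n M)) {a : ℝ} (ha : 0 ≤ a)
    (z : CotangentBundle n M) :
    radialVariable W (fibreScale a z) = a * radialVariable W z := by
  exact gauge_smul_of_nonneg ha _

theorem IsStarShapedDomain.fibreScale_mem (hW : IsStarShapedDomain W) {z : CotangentBundle n M}
    (hz : z ∈ W) {a : ℝ} (h0 : 0 ≤ a) (h1 : a ≤ 1) : fibreScale a z ∈ W :=
  (hW.starConvex z.proj).smul_mem hz h0 h1

variable [T2Space M]

theorem IsStarShapedDomain.mem_frontier (hW : IsStarShapedDomain W) {z : CotangentBundle n M}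
    (hz : z ∈ W) (hz' : z ∉ interior W) : z ∈ frontier W := by
  rw [hW.isCompact.isClosed.frontier_eq]
  exact ⟨hz, hz'⟩

/-- `Y` vanishes on the zero section, so it cannot be transverse to `∂W` there. -/
theorem IsStarShapedDomain.zero_mem_interior (hW : IsStarShapedDomain W) (q : M) :
    (⟨q, 0⟩ : CotangentBundle n M) ∈ interior W := by
  by_contra hq
  obtain ⟨f, -, -, -, -, hf⟩ := hW.boundary _ (hW.mem_frontier (hW.zero_mem q) hq)
  refine hf ?_
  simp [fibreScale]

theorem IsStarShapedDomain.exists_fibreScale_mem (hW : IsStarShapedDomain W)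
    (z : CotangentBundle n M) : ∃ r : ℝ, 0 < r ∧ fibreScale r⁻¹ z ∈ W := by
  have h0 : fibreScale 0 z ∈ interior W := by
    have := hW.zero_mem_interior z.proj
    simpa [fibreScale] using this
  have h1 := (continuous_fibreScale_left z).continuousAt.eventually (isOpen_interior.mem_nhds h0)
  obtain ⟨a, ha, ha'⟩ := ((h1.filter_mono nhdsWithin_le_nhds).and
    (self_mem_nhdsWithin : Ioi (0 : ℝ) ∈ 𝓝[>] 0)).exists
  exact ⟨a⁻¹, inv_pos.2 ha', by simpa using interior_subset ha⟩

/-- Star-shapedness gives membership for every `r > c`; closedness of `W` allows `r → c`. -/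
theorem IsStarShapedDomain.radialVariable_le_iff (hW : IsStarShapedDomain W)
    {z : CotangentBundle n M} {c : ℝ} (hc : 0 < c) :
    radialVariable W z ≤ c ↔ fibreScale c⁻¹ z ∈ W := by
  rw [radialVariable_eq_sInf]
  refine ⟨fun h => ?_, fun h => csInf_le ⟨0, fun r hr => hr.1.le⟩ ⟨hc, h⟩⟩
  have hmem : ∀ r > c, fibreScale r⁻¹ z ∈ W := by
    intro r hr
    obtain ⟨r', ⟨hr'0, hr'W⟩, hr'⟩ := exists_lt_of_csInf_lt (hW.exists_fibreScale_mem z)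
      (h.trans_lt hr)
    have := hW.fibreScale_mem hr'W (a := r' / r) (div_nonneg hr'0.le (hc.trans hr).le)
      ((div_le_one (by linarith)).2 hr'.le)
    rwa [fibreScale_fibreScale, div_mul_eq_mul_div, mul_inv_cancel₀ hr'0.ne', one_div] at this
  have hcont : ContinuousAt (fun r : ℝ => fibreScale r⁻¹ z) c :=
    ContinuousAt.comp (f := fun r : ℝ => (r⁻¹, z)) continuous_fibreScale.continuousAt
      ((continuousAt_inv₀ hc.ne').prodMk continuousAt_const)
  exact hW.isCompact.isClosed.mem_of_tendsto (hcont.tendsto.mono_left nhdsWithin_le_nhds)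
    (eventually_nhdsWithin_of_forall (s := Ioi c) hmem)

/-- If `ρ(z) < 1` at a boundary point, the flow line of `Y` through `z` stays in `W` for small
times, so `f` has a local maximum along it, against transversality. Conversely, an interior point
can be scaled by some `a > 1` without leaving `W`. -/
theorem IsStarShapedDomain.radialVariable_lt_one_iff (hW : IsStarShapedDomain W)
    {z : CotangentBundle n M} : radialVariable W z < 1 ↔ z ∈ interior W := by
  constructor
  · intro h
    have hz : z ∈ W := by
      have := (hW.radialVariable_le_iff one_pos).1 h.le
      rwa [inv_one, fibreScale_one] at this
    by_contra hint
    obtain ⟨f, -, hfW, hf0, -, hf⟩ := hW.boundary z (hW.mem_frontier hz hint)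
    refine hf (IsLocalMax.deriv_eq_zero ?_)
    have hexp : ContinuousAt (fun τ : ℝ => fibreScale (Real.exp τ) z) 0 :=
      ((continuous_fibreScale_left z).comp Real.continuous_exp).continuousAt
    have h1 : ∀ᶠ τ : ℝ in 𝓝 0, Real.exp τ * radialVariable W z < 1 := by
      have : ContinuousAt (fun τ : ℝ => Real.exp τ * radialVariable W z) 0 := by fun_prop
      exact this.eventually (gt_mem_nhds (by simpa using h))
    have h2 : ∀ᶠ τ : ℝ in 𝓝 0, fibreScale (Real.exp τ) z ∈ W ↔
        f (fibreScale (Real.exp τ) z) ≤ 0 := by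
      refine hexp.eventually (p := fun w => w ∈ W ↔ f w ≤ 0) ?_
      change ∀ᶠ w in 𝓝 (fibreScale (Real.exp 0) z), w ∈ W ↔ f w ≤ 0
      rwa [Real.exp_zero, fibreScale_one]
    filter_upwards [h1, h2] with τ hτ1 hτ2
    rw [Real.exp_zero, fibreScale_one, hf0]
    refine hτ2.1 ?_
    rw [← fibreScale_one (fibreScale (Real.exp τ) z), ← inv_one,
      ← hW.radialVariable_le_iff one_pos, radialVariable_fibreScale W (Real.exp_pos τ).le]
    exact hτ1.le
  · intro h
    have h1 : ∀ᶠ a : ℝ in 𝓝 1, fibreScale a z ∈ W := by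
      refine (continuous_fibreScale_left z).continuousAt.eventually ?_
      change W ∈ 𝓝 (fibreScale 1 z)
      rw [fibreScale_one]
      exact mem_interior_iff_mem_nhds.1 h
    obtain ⟨a, ha, ha'⟩ := ((h1.filter_mono nhdsWithin_le_nhds).and
      (self_mem_nhdsWithin : Ioi (1 : ℝ) ∈ 𝓝[>] 1)).exists
    have ha0 : 0 < a := one_pos.trans ha'
    have h2 : radialVariable W z ≤ a⁻¹ := by
      rw [hW.radialVariable_le_iff (inv_pos.2 ha0), inv_inv]
      exact ha
    exact h2.trans_lt (inv_lt_one_of_one_lt₀ ha')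

theorem IsStarShapedDomain.radialVariable_lt_iff (hW : IsStarShapedDomain W)
    {z : CotangentBundle n M} {c : ℝ} (hc : 0 < c) :
    radialVariable W z < c ↔ fibreScale c⁻¹ z ∈ interior W := by
  rw [← hW.radialVariable_lt_one_iff, radialVariable_fibreScale W (inv_pos.2 hc).le,
    inv_mul_lt_iff₀ hc, mul_one]

/-- Strict sublevels are scaled copies of the open set `interior W`, and sublevels are scaled copies
of the closed set `W`. -/
theorem IsStarShapedDomain.continuous_radialVariable (hW : IsStarShapedDomain W) :
    Continuous (radialVariable W) := by
  have hlt : ∀ c > 0, IsOpen (radialVariable W ⁻¹' Iio c) := by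
    intro c hc
    have : radialVariable W ⁻¹' Iio c = fibreScale c⁻¹ ⁻¹' interior W :=
      Set.ext fun z => hW.radialVariable_lt_iff hc
    rw [this]
    exact isOpen_interior.preimage (continuous_fibreScale_const _)
  have hgt : ∀ c > 0, IsOpen (radialVariable W ⁻¹' Ioi c) := by
    intro c hc
    have : radialVariable W ⁻¹' Ioi c = (fibreScale c⁻¹ ⁻¹' W)ᶜ :=
      Set.ext fun z => by
        rw [mem_preimage, mem_Ioi, ← not_le, hW.radialVariable_le_iff hc]
        rfl
    rw [this]
    exact (hW.isCompact.isClosed.preimage (continuous_fibreScale_const _)).isOpen_compl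
  refine OrderTopology.continuous_iff.2 fun c => ⟨?_, ?_⟩
  · rcases lt_trichotomy c 0 with hc | rfl | hc
    · convert isOpen_univ
      exact eq_univ_of_forall fun z => hc.trans_le (radialVariable_nonneg W z)
    · have : radialVariable W ⁻¹' Ioi 0 = ⋃ c > (0 : ℝ), radialVariable W ⁻¹' Ioi c := by
        ext z
        simp only [mem_preimage, mem_Ioi, mem_iUnion, exists_prop]
        exact ⟨fun h => exists_between h, fun ⟨c, h1, h2⟩ => h1.trans h2⟩
      rw [this]
      exact isOpen_biUnion hgt
    · exact hgt c hc
  · rcases le_or_gt c 0 with hc | hc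
    · convert isOpen_empty
      exact eq_empty_of_forall_notMem fun z hz =>
        (hc.trans (radialVariable_nonneg W z)).not_gt hz
    · exact hlt c hc

theorem IsStarShapedDomain.isCompact_radialVariable_le (hW : IsStarShapedDomain W) {c : ℝ}
    (hc : 0 < c) : IsCompact {z : CotangentBundle n M | radialVariable W z ≤ c} := by
  have : {z : CotangentBundle n M | radialVariable W z ≤ c} = fibreScale c '' W := by
    ext z
    rw [mem_ofPred_eq, hW.radialVariable_le_iff hc]
    constructor
    · intro h
      exact ⟨_, h, by rw [fibreScale_fibreScale, mul_inv_cancel₀ hc.ne', fibreScale_one]⟩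
    · rintro ⟨w, hw, rfl⟩
      rwa [fibreScale_fibreScale, inv_mul_cancel₀ hc.ne', fibreScale_one]
  rw [this]
  exact hW.isCompact.image (continuous_fibreScale_const c)

end Radial

/-- A continuous solution `a` of `Φ(y, a(y)) = 0` is differentiable where `∂Φ/∂a ≠ 0`. -/
theorem differentiableAt_of_implicit_eq {G : Type*} [NormedAddCommGroup G] [NormedSpace ℝ G]
    [CompleteSpace G] {Φ : G × ℝ → ℝ} {a : G → ℝ} {y : G} (hΦ : ContDiffAt ℝ 1 Φ (y, a y))
    (ha : ContinuousAt a y) (heq : ∀ᶠ y' in 𝓝 y, Φ (y', a y') = 0)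
    (hd : deriv (fun r => Φ (y, r)) (a y) ≠ 0) : DifferentiableAt ℝ a y := by
  have hs := hΦ.hasStrictFDerivAt one_ne_zero
  set Φ' := fderiv ℝ Φ (y, a y)
  have hder : deriv (fun r => Φ (y, r)) (a y) = Φ' (0, 1) :=
    (hs.hasFDerivAt.comp_hasDerivAt (a y) ((hasDerivAt_const (a y) y).prodMk
      (hasDerivAt_id' (a y)))).deriv
  rw [hder] at hd
  have hinv : (Φ' ∘L .inr ℝ G ℝ).IsInvertible := by
    have h1 : ∀ r : ℝ, Φ' (0, r) = r * Φ' (0, 1) := by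
      intro r
      rw [← smul_eq_mul, ← map_smul]
      simp
    refine ContinuousLinearMap.IsInvertible.of_inverse
      (g := (Φ' (0, 1))⁻¹ • ContinuousLinearMap.id ℝ ℝ) ?_ ?_
    · ext
      simp [hd]
    · ext
      simp [hd]
  have h1 := hs.eventually_apply_eq_iff_implicitFunctionOfProdDomain hinv
  have h2 : ContinuousAt (fun y' => (y', a y')) y := continuousAt_id.prodMk ha
  -- Continuity keeps the graph of `a` in the neighbourhood where the implicit solution is unique.
  have h3 : a =ᶠ[𝓝 y] hs.implicitFunctionOfProdDomain hinv := by
    filter_upwards [h2.eventually h1, heq] with y' h4 h5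
    exact (h4.1 (h5.trans heq.self_of_nhds.symm)).symm
  exact ((hs.hasStrictFDerivAt_implicitFunctionOfProdDomain
    hinv).hasFDerivAt.differentiableAt).congr_of_eventuallyEq h3

/-! ### The radial variable: differentiability off the zero section -/

section Radial

variable {n : ℕ} {M : Type*} [TopologicalSpace M] [ChartedSpace (EuclideanSpace ℝ (Fin n)) M]
  [IsManifold (𝓡 n) ∞ M] [T2Space M] {W : Set (CotangentBundle n M)}

theorem IsStarShapedDomain.mem_frontier_of_radialVariable_eq_one (hW : IsStarShapedDomain W)
    {z : CotangentBundle n M} (hz : radialVariable W z = 1) : z ∈ frontier W := by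
  refine hW.mem_frontier ?_ fun h => (hW.radialVariable_lt_one_iff.2 h).ne hz
  have := (hW.radialVariable_le_iff one_pos).1 hz.le
  rwa [inv_one, fibreScale_one] at this

/-- The radial variable is differentiable off the zero section: here in the preferred chart. -/
theorem IsStarShapedDomain.differentiableAt_radialVariable_chart (hW : IsStarShapedDomain W)
    {z : CotangentBundle n M} (hz : 0 < radialVariable W z) :
    DifferentiableAt ℝ (radialVariable W ∘ (cotangentChart z).symm) (cotangentChart z z) := by
  set r := radialVariable W z with hr
  set y := cotangentChart z z with hy
  have hzs : z ∈ (cotangentChart z).source := mem_extChartAt_source z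
  have hyt : y ∈ (cotangentChart z).target := (cotangentChart z).map_source hzs
  have hsymm : (cotangentChart z).symm y = z := (cotangentChart z).left_inv hzs
  have hz₁ : radialVariable W (fibreScale r⁻¹ z) = 1 := by
    rw [radialVariable_fibreScale W (inv_pos.2 hz).le, inv_mul_cancel₀ hz.ne']
  obtain ⟨f, hf, hfW, hf0, -, hfd⟩ :=
    hW.boundary _ (hW.mem_frontier_of_radialVariable_eq_one hz₁)
  -- the boundary is contained in the zero set of `f`
  have hf1 : ContMDiffAt (cotangentModel n) 𝓘(ℝ, ℝ) 1 f (fibreScale r⁻¹ z) :=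
    hf.of_le (by simp)
  have hzero : ∀ᶠ w in 𝓝 (fibreScale r⁻¹ z), radialVariable W w = 1 → f w = 0 := by
    filter_upwards [hfW.eventually_nhds, (contMDiffAt_iff_contMDiffAt_nhds (by simp)).1 hf1]
      with w hw hwc hw1
    have hfr := hW.mem_frontier_of_radialVariable_eq_one hw1
    refine le_antisymm (hw.self_of_nhds.1 (hW.isCompact.isClosed.frontier_subset hfr)) ?_
    by_contra! hlt
    refine (hW.isCompact.isClosed.frontier_eq ▸ hfr).2 (mem_interior_iff_mem_nhds.2 ?_)
    filter_upwards [hw, hwc.continuousAt.eventually (gt_mem_nhds hlt)] with w' h1 h2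
    exact h1.2 h2.le
  -- With `Φ((q, p), a) = f(q, a p)`, the function `a = 1/ρ` solves `Φ = 0`, because `(q, p/ρ)` lies
  -- on `∂W`.
  set Φ : CotangentSpace n × ℝ → ℝ :=
    fun x => f ((cotangentChart z).symm (x.1.1, x.2 • x.1.2)) with hΦ
  have hρc : ContinuousAt (radialVariable W ∘ (cotangentChart z).symm) y :=
    hW.continuous_radialVariable.continuousAt.comp (continuousAt_extChartAt_symm z)
  have hρy : (radialVariable W ∘ (cotangentChart z).symm) y = r := by
    rw [Function.comp_apply, hsymm]
  have hpos : ∀ᶠ y' in 𝓝 y, 0 < (radialVariable W ∘ (cotangentChart z).symm) y' :=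
    hρc.eventually (lt_mem_nhds (by rwa [hρy]))
  have hΦc : ContDiffAt ℝ 1 Φ (y, r⁻¹) := by
    have h1 : ContMDiffAt 𝓘(ℝ, CotangentSpace n) (cotangentModel n) 1 (cotangentChart z).symm
        (y.1, r⁻¹ • y.2) := by
      refine (contMDiffOn_extChartAt_symm z).contMDiffAt
        ((isOpen_extChartAt_target z).mem_nhds ?_)
      rw [hy, ← cotangentChart_fibreScale]
      exact (cotangentChart z).map_source (fibreScale_mem_source.2 hzs)
    have h2 : ContMDiffAt 𝓘(ℝ, CotangentSpace n) 𝓘(ℝ, ℝ) 1 (f ∘ (cotangentChart z).symm)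
        (y.1, r⁻¹ • y.2) := by
      refine ContMDiffAt.comp _ ?_ h1
      rwa [cotangentChart_symm_smul hyt, hsymm]
    exact h2.contDiffAt.comp (y, r⁻¹) (f := fun x : CotangentSpace n × ℝ => (x.1.1, x.2 • x.1.2))
      (by fun_prop)
  suffices h : DifferentiableAt ℝ
      (fun y' => ((radialVariable W ∘ (cotangentChart z).symm) y')⁻¹) y by
    refine (h.inv (by rw [hρy]; exact (inv_pos.2 hz).ne')).congr_of_eventuallyEq
      (Eventually.of_forall fun y' => ?_)
    simp
  refine differentiableAt_of_implicit_eq (Φ := Φ) (by rwa [hρy]) ?_ ?_ ?_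
  · exact hρc.inv₀ (by rw [hρy]; exact hz.ne')
  · have h1 : ContinuousAt (fun y' => fibreScale
        ((radialVariable W ∘ (cotangentChart z).symm) y')⁻¹ ((cotangentChart z).symm y')) y :=
      continuous_fibreScale.continuousAt.comp
        ((hρc.inv₀ (by rw [hρy]; exact hz.ne')).prodMk (continuousAt_extChartAt_symm z))
    have h2 := h1.eventually (p := fun w => radialVariable W w = 1 → f w = 0)
      (by simpa only [hρy, hsymm] using hzero)
    filter_upwards [h2, hpos, extChartAt_target_mem_nhds z] with y' h3 h4 h5
    simp only [hΦ]
    rw [cotangentChart_symm_smul h5]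
    refine h3 ?_
    rw [radialVariable_fibreScale W (inv_pos.2 h4).le]
    exact inv_mul_cancel₀ h4.ne'
  -- `∂Φ/∂a ≠ 0` is transversality: `df[Y]` at the boundary point is `r⁻¹ ∂Φ/∂a`.
  · rw [hρy]
    intro hd
    refine hfd ?_
    have h1 : (fun τ : ℝ => f (fibreScale (Real.exp τ) (fibreScale r⁻¹ z))) =
        (fun a => Φ (y, a)) ∘ fun τ => Real.exp τ * r⁻¹ := by
      ext τ
      simp only [hΦ, Function.comp_apply]
      rw [cotangentChart_symm_smul hyt, hsymm, fibreScale_fibreScale]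
    rw [h1]
    have hdiff : DifferentiableAt ℝ (fun a => Φ (y, a)) r⁻¹ :=
      (hΦc.differentiableAt one_ne_zero).comp r⁻¹ (f := fun a => (y, a)) (by fun_prop)
    have h2 : HasDerivAt (fun τ : ℝ => Real.exp τ * r⁻¹) (1 * r⁻¹) 0 := by
      simpa using (Real.hasDerivAt_exp 0).mul_const r⁻¹
    have h3 : HasDerivAt (fun a => Φ (y, a)) 0 (Real.exp 0 * r⁻¹) := by
      rw [Real.exp_zero, one_mul, ← hd]
      exact hdiff.hasDerivAt
    simpa using (h3.comp 0 h2).deriv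

theorem IsStarShapedDomain.hasMFDerivAt_radialVariable (hW : IsStarShapedDomain W)
    {z : CotangentBundle n M} (hz : 0 < radialVariable W z) :
    HasMFDerivAt (cotangentModel n) 𝓘(ℝ, ℝ) (radialVariable W) z
      ((fderiv ℝ (radialVariable W ∘ (cotangentChart z).symm) (cotangentChart z z)).comp
        (chartDeriv z z)) := by
  have h1 := (hW.differentiableAt_radialVariable_chart hz).hasFDerivAt.hasMFDerivAt.comp z
    (hasMFDerivAt_cotangentChart (mem_extChartAt_source z))
  refine h1.congr_of_eventuallyEq ?_
  filter_upwards [extChartAt_source_mem_nhds (I := cotangentModel n) z] with w hw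
  exact congrArg (radialVariable W) ((cotangentChart z).left_inv hw).symm

theorem IsStarShapedDomain.mdifferentiableAt_radialVariable (hW : IsStarShapedDomain W)
    {z : CotangentBundle n M} (hz : 0 < radialVariable W z) :
    MDifferentiableAt (cotangentModel n) 𝓘(ℝ, ℝ) (radialVariable W) z :=
  (hW.hasMFDerivAt_radialVariable hz).mdifferentiableAt

/-- `dρ[Y] = ρ` off the zero section. -/
theorem IsStarShapedDomain.mfderiv_radialVariable_liouvilleVectorField
    (hW : IsStarShapedDomain W) {z : CotangentBundle n M} (hz : 0 < radialVariable W z) :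
    mfderiv (cotangentModel n) 𝓘(ℝ, ℝ) (radialVariable W) z (liouvilleVectorField z) =
      radialVariable W z := by
  rw [(hW.hasMFDerivAt_radialVariable hz).mfderiv]
  change fderiv ℝ (radialVariable W ∘ (cotangentChart z).symm) (cotangentChart z z)
    (chartDeriv z z (liouvilleVectorField z)) = _
  rw [chartDeriv_liouvilleVectorField]
  have h1 := (hW.differentiableAt_radialVariable_chart hz).hasFDerivAt.hasLineDerivAt
    (0, (cotangentChart z z).2)
  refine HasDerivAt.unique h1 ?_
  -- In coordinates `Y = (0, p)`, and homogeneity gives `ρ(q, (1 + τ) p) = (1 + τ) ρ(q, p)`.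
  have h2 : HasDerivAt (fun τ : ℝ => (1 + τ) * radialVariable W z) (1 * radialVariable W z) 0 :=
    ((hasDerivAt_id' (0 : ℝ)).const_add 1).mul_const _
  rw [one_mul] at h2
  refine h2.congr_of_eventuallyEq ?_
  filter_upwards [lt_mem_nhds (show (-1 : ℝ) < 0 by norm_num)] with τ hτ
  have h3 : cotangentChart z z + τ • ((0, (cotangentChart z z).2) : CotangentSpace n) =
      ((cotangentChart z z).1, (1 + τ) • (cotangentChart z z).2) := by
    ext1
    · simp
    · simp [add_smul]
  rw [h3, Function.comp_apply, cotangentChart_symm_smul (mem_extChartAt_target z),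
    (cotangentChart z).left_inv (mem_extChartAt_source z),
    radialVariable_fibreScale W (by linarith)]

end Radial

theorem ContDiffOn.hasDerivAt_derivWithin_Ici {h : ℝ → ℝ} {a r : ℝ}
    (hh : ContDiffOn ℝ ∞ h (Ici a)) (hr : a < r) :
    HasDerivAt h (derivWithin h (Ici a) r) r :=
  ((hh.differentiableOn (by simp)) r hr.le).hasDerivWithinAt.hasDerivAt (Ici_mem_nhds hr)

theorem ContDiffOn.derivWithin_Ici {h : ℝ → ℝ} {a : ℝ} (hh : ContDiffOn ℝ ∞ h (Ici a)) :
    ContDiffOn ℝ ∞ (derivWithin h (Ici a)) (Ici a) :=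
  hh.derivWithin (uniqueDiffOn_Ici a) le_rfl

/-! ### Radial Hamiltonians and the pointwise Floer equation -/

section RadialHamiltonian

variable {n : ℕ} {M : Type*} [TopologicalSpace M] [ChartedSpace (EuclideanSpace ℝ (Fin n)) M]
  [IsManifold (𝓡 n) ∞ M] [T2Space M] {W : Set (CotangentBundle n M)}
  {H : CotangentBundle n M → ℝ} {ρ₀ : ℝ} {h : ℝ → ℝ} {z : CotangentBundle n M}

theorem differentialAt_radialHamiltonian (hW : IsStarShapedDomain W) (hρ₀ : 0 < ρ₀)
    (hh : ContDiffOn ℝ ∞ h (Ici ρ₀))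
    (hH : ∀ z, ρ₀ ≤ radialVariable W z → H z = h (radialVariable W z))
    (hz : ρ₀ < radialVariable W z) (ξ : TangentSpace (cotangentModel n) z) :
    differentialAt H z ξ = derivWithin h (Ici ρ₀) (radialVariable W z) *
      differentialAt (radialVariable W) z ξ := by
  have h1 := (hh.hasDerivAt_derivWithin_Ici hz).hasFDerivAt.hasMFDerivAt.comp z
    (hW.mdifferentiableAt_radialVariable (hρ₀.trans hz)).hasMFDerivAt
  have h2 : H =ᶠ[𝓝 z] h ∘ radialVariable W := by
    filter_upwards [hW.continuous_radialVariable.continuousAt.eventually (lt_mem_nhds hz)]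
      with w hw using hH w hw.le
  have h3 := DFunLike.congr_fun (h1.congr_of_eventuallyEq h2).mfderiv ξ
  refine h3.trans ?_
  change differentialAt (radialVariable W) z ξ *
    derivWithin h (Ici ρ₀) (radialVariable W z) = _
  exact mul_comm _ _

/-- `λ(X_H) = ω(Y, X_H) = dH[Y] = h'(ρ) dρ[Y]`, and `dρ[Y] = ρ`. -/
theorem liouvilleForm_hamiltonianVectorField (hW : IsStarShapedDomain W) (hρ₀ : 0 < ρ₀)
    (hh : ContDiffOn ℝ ∞ h (Ici ρ₀))
    (hH : ∀ z, ρ₀ ≤ radialVariable W z → H z = h (radialVariable W z))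
    (hz : ρ₀ < radialVariable W z) :
    liouvilleForm z (hamiltonianVectorField symplecticForm H z) =
      derivWithin h (Ici ρ₀) (radialVariable W z) * radialVariable W z := by
  rw [← symplecticForm_liouvilleVectorField, symplecticForm_swap,
    symplecticForm_hamiltonianVectorField_left, neg_neg,
    differentialAt_radialHamiltonian hW hρ₀ hh hH hz]
  exact congrArg _ (hW.mfderiv_radialVariable_liouvilleVectorField (hρ₀.trans hz))

variable {J : ∀ z : CotangentBundle n M,
      TangentSpace (cotangentModel n) z →L[ℝ] TangentSpace (cotangentModel n) z}

/-- `0 = dH[X_H] = h'(ρ) dρ[X_H]` by antisymmetry. Where `h'(ρ) = 0` one has `dH = 0`, and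
positivity of `g_J` forces `X_H = 0`. -/
theorem differentialAt_radialVariable_hamiltonianVectorField (hW : IsStarShapedDomain W) (hρ₀ : 0 < ρ₀)
    (hh : ContDiffOn ℝ ∞ h (Ici ρ₀))
    (hH : ∀ z, ρ₀ ≤ radialVariable W z → H z = h (radialVariable W z))
    (hJ : IsCompatibleWith symplecticForm J) (hz : ρ₀ < radialVariable W z) :
    differentialAt (radialVariable W) z
      (hamiltonianVectorField symplecticForm H z) = 0 := by
  set X := hamiltonianVectorField symplecticForm H z with hX
  have hXω := symplecticForm_hamiltonianVectorField_left H z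
  rw [← hX] at hXω
  have hdH := differentialAt_radialHamiltonian hW hρ₀ hh hH hz
  by_cases h0 : derivWithin h (Ici ρ₀) (radialVariable W z) = 0
  · have h1 : X = 0 := by
      by_contra hne
      have h2 := (hJ z).2.2 X hne
      rw [symplecticForm_swap, hXω, hdH, h0, zero_mul, neg_zero, neg_zero] at h2
      exact lt_irrefl _ h2
    rw [h1]
    exact (differentialAt (radialVariable W) z).map_zero
  · have h1 := hXω X
    rw [symplecticForm_self, hdH, zero_eq_neg] at h1
    exact (mul_eq_zero.1 h1).resolve_left h0

/-- The consequences of the Floer equation `ξ + J (η - X_H) = 0`, where `ξ = ∂ₛ u` and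
`η = ∂ₜ u`, at a point where the Hamiltonian is radial and `J` is of contact type. -/
theorem floer_radial (hW : IsStarShapedDomain W) (hρ₀ : 0 < ρ₀)
    (hh : ContDiffOn ℝ ∞ h (Ici ρ₀))
    (hH : ∀ z, ρ₀ ≤ radialVariable W z → H z = h (radialVariable W z))
    (hJ : IsCompatibleWith symplecticForm J) (hz : ρ₀ < radialVariable W z)
    (hcontact : ∀ ξ : TangentSpace (cotangentModel n) z,
      differentialAt (radialVariable W) z (J z ξ) = liouvilleForm z ξ)
    {ξ η : TangentSpace (cotangentModel n) z}
    (hF : ξ + J z (η - hamiltonianVectorField symplecticForm H z) = 0) :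
    differentialAt (radialVariable W) z ξ = -liouvilleForm z η +
        derivWithin h (Ici ρ₀) (radialVariable W z) * radialVariable W z ∧
      differentialAt (radialVariable W) z η = liouvilleForm z ξ ∧
      symplecticForm z ξ η ≤ derivWithin h (Ici ρ₀) (radialVariable W z) *
        differentialAt (radialVariable W) z ξ := by
  set X := hamiltonianVectorField symplecticForm H z with hX
  have hξ : ξ = J z (-(η - X)) := by
    rw [ContinuousLinearMap.map_neg]
    exact eq_neg_of_add_eq_zero_left hF
  have hη : η = J z ξ + X := by
    rw [hξ, (hJ z).1, neg_neg, sub_add_cancel]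
  refine ⟨?_, ?_, ?_⟩
  · have h1 := hcontact (-(η - X))
    rw [← hξ] at h1
    rw [h1, ← liouvilleForm_hamiltonianVectorField hW hρ₀ hh hH hz, ← hX]
    have h2 : liouvilleForm z (-(η - X)) = -(liouvilleForm z η - liouvilleForm z X) := by
      rw [ContinuousLinearMap.map_neg, ContinuousLinearMap.map_sub]
    rw [h2]
    ring
  · have h1 : differentialAt (radialVariable W) z (J z ξ + X) =
        differentialAt (radialVariable W) z (J z ξ) +
          differentialAt (radialVariable W) z X :=
      (differentialAt (radialVariable W) z).map_add _ _
    rw [← hη, hcontact, differentialAt_radialVariable_hamiltonianVectorField hW hρ₀ hh hH hJ hz] at h1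
    exact h1.trans (add_zero _)
  · have h1 : 0 ≤ symplecticForm z (J z ξ) ξ := by
      by_cases h0 : ξ = 0
      · rw [h0, ContinuousLinearMap.map_zero, symplecticForm_self]
      · exact ((hJ z).2.2 ξ h0).le
    -- Here `ω(ξ, Jξ) = -|ξ|² ≤ 0` and `ω(ξ, X_H) = dH[ξ] = h'(ρ) dρ[ξ]`.
    have h2 : symplecticForm z ξ η = symplecticForm z ξ (J z ξ) + symplecticForm z ξ X := by
      rw [← symplecticForm_add_right, ← hη]
    rw [h2, symplecticForm_swap z ξ, symplecticForm_swap z ξ X,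
      symplecticForm_hamiltonianVectorField_left H z ξ, differentialAt_radialHamiltonian hW hρ₀ hh hH hz]
    linarith

/-- `d_p H[p] = ρ h'(ρ)` for the radial Hamiltonian `H = h ∘ ρ`. -/
theorem fibreDeriv_radialHamiltonian (hW : IsStarShapedDomain W)
    (hh : ContDiffOn ℝ ∞ h (Ici ρ₀))
    (hH : ∀ z, ρ₀ ≤ radialVariable W z → H z = h (radialVariable W z))
    (hz : ρ₀ < radialVariable W z) :
    fibreDeriv H z z.snd =
      derivWithin h (Ici ρ₀) (radialVariable W z) * radialVariable W z := by
  have hscale : ∀ ε : ℝ, (⟨z.proj, z.snd + ε • z.snd⟩ : CotangentBundle n M) =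
      fibreScale (1 + ε) z := fun ε =>
    congrArg (TotalSpace.mk z.proj) (by rw [add_smul, one_smul])
  have h1 : HasDerivAt (fun ε : ℝ => (1 + ε) * radialVariable W z) (1 * radialVariable W z) 0 :=
    ((hasDerivAt_id' (0 : ℝ)).const_add 1).mul_const _
  have h2 : HasDerivAt h (derivWithin h (Ici ρ₀) (radialVariable W z))
      ((1 + 0) * radialVariable W z) := by
    rw [add_zero, one_mul]
    exact hh.hasDerivAt_derivWithin_Ici hz
  have h3 := h2.comp 0 h1
  rw [one_mul] at h3
  refine (h3.congr_of_eventuallyEq ?_).deriv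
  have h4 : ContinuousAt (fun ε : ℝ => radialVariable W (fibreScale (1 + ε) z)) 0 :=
    (hW.continuous_radialVariable.comp ((continuous_fibreScale_left z).comp
      (continuous_const.add continuous_id))).continuousAt
  filter_upwards [h4.eventually (lt_mem_nhds (by simpa [fibreScale_one] using hz)),
    lt_mem_nhds (show (-1 : ℝ) < 0 by norm_num)] with ε hε hε'
  rw [hscale, hH _ hε.le, radialVariable_fibreScale W (by linarith)]
  rfl

end RadialHamiltonian

/-! ### First derivatives of `ρ ∘ u`, up to the boundary -/

section Cylinder

variable {n : ℕ} {M : Type*} [TopologicalSpace M] [ChartedSpace (EuclideanSpace ℝ (Fin n)) M]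
  [IsManifold (𝓡 n) ∞ M] [T2Space M] {W : Set (CotangentBundle n M)}
  {u : ℝ × ℝ → CotangentBundle n M}

theorem hasFDerivWithinAt_radialVariable_comp (hW : IsStarShapedDomain W)
    (hu : ContMDiffOn 𝓘(ℝ, ℝ × ℝ) (cotangentModel n) ∞ u halfPlane) {p : ℝ × ℝ}
    (hp : p ∈ halfPlane) (hpos : 0 < radialVariable W (u p)) :
    ∃ L : ℝ × ℝ →L[ℝ] ℝ, HasFDerivWithinAt (fun q => radialVariable W (u q)) L halfPlane p ∧
      L (1, 0) = differentialAt (radialVariable W) (u p)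
        (dS (cotangentModel n) u p) ∧
      L (0, 1) = differentialAt (radialVariable W) (u p)
        (dT (cotangentModel n) u p) := by
  have h1 := (hW.mdifferentiableAt_radialVariable hpos).hasMFDerivAt.comp_hasMFDerivWithinAt p
    ((hu p hp).mdifferentiableWithinAt (by simp)).hasMFDerivWithinAt
  exact ⟨_, hasMFDerivWithinAt_iff_hasFDerivWithinAt.1 h1, rfl, rfl⟩

end Cylinder

/-! ### The differential inequality for `ρ ∘ u` -/

section Laplacian

variable {n : ℕ} {M : Type*} [TopologicalSpace M] [ChartedSpace (EuclideanSpace ℝ (Fin n)) M]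
  [IsManifold (𝓡 n) ∞ M] [T2Space M] {W : Set (CotangentBundle n M)}
  {H : ℝ → CotangentBundle n M → ℝ} {ρ₀ : ℝ} {h : ℝ → ℝ}
  {J : ℝ → ∀ z : CotangentBundle n M,
    TangentSpace (cotangentModel n) z →L[ℝ] TangentSpace (cotangentModel n) z}
  {u : ℝ × ℝ → CotangentBundle n M}

/-- The first derivatives of `ρ ∘ u` along a solution `u` of the Floer equation. -/
theorem radialVariable_floer_hasFDerivWithinAt (hW : IsStarShapedDomain W) (hρ₀ : 0 < ρ₀)
    (hrad : IsRadialOutside W H ρ₀ h) (hJω : ∀ t, IsCompatibleWith symplecticForm (J t))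
    (hcontact : IsContactTypeOutside W J ρ₀)
    (hu : ContMDiffOn 𝓘(ℝ, ℝ × ℝ) (cotangentModel n) ∞ u halfPlane)
    (hF : ∀ p ∈ halfPlane, dS (cotangentModel n) u p + J p.2 (u p) (dT (cotangentModel n) u p -
      hamiltonianVectorField symplecticForm (H p.2) (u p)) = 0)
    {p : ℝ × ℝ} (hp : p ∈ halfPlane) (hρ : ρ₀ < radialVariable W (u p)) :
    ∃ L : ℝ × ℝ →L[ℝ] ℝ, HasFDerivWithinAt (fun q => radialVariable W (u q)) L halfPlane p ∧
      L (1, 0) = -liouvilleForm (u p) (dT (cotangentModel n) u p) +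
        derivWithin h (Ici ρ₀) (radialVariable W (u p)) * radialVariable W (u p) ∧
      L (0, 1) = liouvilleForm (u p) (dS (cotangentModel n) u p) ∧
      symplecticForm (u p) (dS (cotangentModel n) u p) (dT (cotangentModel n) u p) ≤
        derivWithin h (Ici ρ₀) (radialVariable W (u p)) * L (1, 0) := by
  obtain ⟨L, hL, hL1, hL2⟩ := hasFDerivWithinAt_radialVariable_comp hW hu hp (hρ₀.trans hρ)
  obtain ⟨h1, h2, h3⟩ := floer_radial hW hρ₀ hrad.1 (hrad.2 p.2) (hJω p.2) hρ
    (hcontact p.2 (u p) hρ.le) (hF p hp)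
  exact ⟨L, hL, hL1.trans h1, hL2.trans h2, h3.trans_eq (by rw [hL1])⟩

/-- Along a solution `u` of the Floer equation, `v = ρ ∘ u` is twice differentiable in each
variable and satisfies `Δ v ≥ v h''(v) ∂ₛ v` where `v > ρ₀`. -/
theorem laplacian_radialVariable_floer (hW : IsStarShapedDomain W) (hρ₀ : 0 < ρ₀)
    (hrad : IsRadialOutside W H ρ₀ h) (hJω : ∀ t, IsCompatibleWith symplecticForm (J t))
    (hcontact : IsContactTypeOutside W J ρ₀)
    (hu : ContMDiffOn 𝓘(ℝ, ℝ × ℝ) (cotangentModel n) ∞ u halfPlane)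
    (hF : ∀ p ∈ halfPlane, dS (cotangentModel n) u p + J p.2 (u p) (dT (cotangentModel n) u p -
      hamiltonianVectorField symplecticForm (H p.2) (u p)) = 0)
    {s t : ℝ} (hs : s < 0) (hρ : ρ₀ < radialVariable W (u (s, t))) :
    DifferentiableAt ℝ (fun σ => radialVariable W (u (σ, t))) s ∧
      DifferentiableAt ℝ (deriv fun σ => radialVariable W (u (σ, t))) s ∧
      radialVariable W (u (s, t)) *
          derivWithin (derivWithin h (Ici ρ₀)) (Ici ρ₀) (radialVariable W (u (s, t))) *
          deriv (fun σ => radialVariable W (u (σ, t))) s ≤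
        deriv (deriv fun σ => radialVariable W (u (σ, t))) s +
          deriv (deriv fun τ => radialVariable W (u (s, τ))) t := by
  set v : ℝ × ℝ → ℝ := fun q => radialVariable W (u q) with hv
  set A : ℝ × ℝ → ℝ := fun q => liouvilleForm (u q)
    (mfderiv 𝓘(ℝ, ℝ × ℝ) (cotangentModel n) u q ((0, 1) : ℝ × ℝ)) with hA
  set B : ℝ × ℝ → ℝ := fun q => liouvilleForm (u q)
    (mfderiv 𝓘(ℝ, ℝ × ℝ) (cotangentModel n) u q ((1, 0) : ℝ × ℝ)) with hB
  set h₁ := derivWithin h (Ici ρ₀) with hh₁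
  have hnhds := halfPlane_mem_nhds hs t
  have hu' : ContMDiffAt 𝓘(ℝ, ℝ × ℝ) (cotangentModel n) ∞ u (s, t) := hu.contMDiffAt hnhds
  have hlineS : ∀ σ, HasDerivAt (fun σ : ℝ => (σ, t)) ((1, 0) : ℝ × ℝ) σ := fun σ =>
    (hasDerivAt_id' σ).prodMk (hasDerivAt_const σ t)
  have hlineT : ∀ τ, HasDerivAt (fun τ : ℝ => (s, τ)) ((0, 1) : ℝ × ℝ) τ := fun τ =>
    (hasDerivAt_const τ s).prodMk (hasDerivAt_id' τ)
  have hfirst : ∀ q : ℝ × ℝ, q.1 < 0 → ρ₀ < v q → ∃ L : ℝ × ℝ →L[ℝ] ℝ, HasFDerivAt v L q ∧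
      L (1, 0) = -A q + h₁ (v q) * v q ∧ L (0, 1) = B q ∧
      symplecticForm (u q) (mfderiv 𝓘(ℝ, ℝ × ℝ) (cotangentModel n) u q ((1, 0) : ℝ × ℝ))
        (mfderiv 𝓘(ℝ, ℝ × ℝ) (cotangentModel n) u q ((0, 1) : ℝ × ℝ)) ≤
        h₁ (v q) * L (1, 0) := by
    intro q hq hqρ
    obtain ⟨L, hL, h1, h2, h3⟩ := radialVariable_floer_hasFDerivWithinAt hW hρ₀ hrad hJω hcontact
      hu hF (show q ∈ halfPlane from hq.le) hqρ
    rw [dT_eq_mfderiv hq] at h1 h3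
    rw [dS_eq_mfderiv hq] at h2 h3
    exact ⟨L, hL.hasFDerivAt (halfPlane_mem_nhds hq q.2), h1, h2, h3⟩
  obtain ⟨L, hL, hL1, hL2, hL3⟩ := hfirst (s, t) hs hρ
  obtain ⟨LB, LA, hLB, hLA, hω⟩ := pullback_liouvilleForm hu' ((1, 0) : ℝ × ℝ) ((0, 1) : ℝ × ℝ)
  have hev : ∀ᶠ q : ℝ × ℝ in 𝓝 (s, t), q.1 < 0 ∧ ρ₀ < v q :=
    (continuousAt_fst.eventually (gt_mem_nhds hs)).and
      (hL.continuousAt.eventually (lt_mem_nhds hρ))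
  have hvS : HasDerivAt (fun σ => v (σ, t)) (L (1, 0)) s :=
    HasFDerivAt.comp_hasDerivAt (f := fun σ => (σ, t)) s hL (hlineS s)
  -- The first-order formulas hold on a neighbourhood, so they can be differentiated again without
  -- second derivatives of `ρ`.
  have hdS : deriv (fun σ => v (σ, t)) =ᶠ[𝓝 s]
      fun σ => -A (σ, t) + h₁ (v (σ, t)) * v (σ, t) := by
    filter_upwards [(hlineS s).continuousAt.eventually hev] with σ hσ
    obtain ⟨L', hL', h1, -⟩ := hfirst (σ, t) hσ.1 hσ.2
    rw [← h1]
    exact (hL'.comp_hasDerivAt σ (hlineS σ)).deriv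
  have hdT : deriv (fun τ => v (s, τ)) =ᶠ[𝓝 t] fun τ => B (s, τ) := by
    filter_upwards [(hlineT t).continuousAt.eventually hev] with τ hτ
    obtain ⟨L', hL', -, h2, -⟩ := hfirst (s, τ) hτ.1 hτ.2
    rw [← h2]
    exact (hL'.comp_hasDerivAt τ (hlineT τ)).deriv
  have hddS : HasDerivAt (deriv fun σ => v (σ, t)) (-LA (1, 0) +
      (derivWithin h₁ (Ici ρ₀) (v (s, t)) * L (1, 0) * v (s, t) + h₁ (v (s, t)) * L (1, 0))) s := by
    refine HasDerivAt.congr_of_eventuallyEq ?_ hdS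
    have h1 : HasDerivAt (fun σ => A (σ, t)) (LA (1, 0)) s :=
      HasFDerivAt.comp_hasDerivAt (f := fun σ => (σ, t)) s hLA (hlineS s)
    have h2 : HasDerivAt (fun σ => h₁ (v (σ, t)))
        (derivWithin h₁ (Ici ρ₀) (v (s, t)) * L (1, 0)) s :=
      HasDerivAt.comp s (hrad.1.derivWithin_Ici.hasDerivAt_derivWithin_Ici hρ) hvS
    exact h1.neg.add (h2.mul hvS)
  have hddT : deriv (deriv fun τ => v (s, τ)) t = LB (0, 1) := by
    rw [hdT.deriv_eq]
    exact (hLB.comp_hasDerivAt t (hlineT t)).deriv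
  refine ⟨hvS.differentiableAt, hddS.differentiableAt, ?_⟩
  rw [hddT, hddS.deriv, hvS.deriv]
  -- `LA (1, 0) - LB (0, 1) = ω(∂ₛ u, ∂ₜ u)`, which is at most `h'(v) ∂ₛ v`. This absorbs the term
  -- `h'(v) ∂ₛ v` of `∂ₛ(v h'(v))` and leaves `v h''(v) ∂ₛ v`.
  rw [← hω] at hL3
  linarith

end Laplacian

end

theorem mainTheorem8 {n : ℕ} {M : Type*} [TopologicalSpace M]
    [ChartedSpace (EuclideanSpace ℝ (Fin n)) M] [IsManifold (𝓡 n) ∞ M]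
    [CompactSpace M] [T2Space M]
    (W : Set (CotangentBundle n M)) (hW : IsStarShapedDomain W)
    (H : ℝ → CotangentBundle n M → ℝ) (hH : IsSmoothPeriodicFunction (cotangentModel n) H)
    (J : ℝ → ∀ z : CotangentBundle n M,
      TangentSpace (cotangentModel n) z →L[ℝ] TangentSpace (cotangentModel n) z)
    (hJ : IsSmoothPeriodicEndomorphism J) (hJω : ∀ t, IsCompatibleWith symplecticForm (J t))
    (x : ℝ → CotangentBundle n M) (hx : IsPeriodicOrbit symplecticForm H x)
    (ρ₀ : ℝ) (hρ₀ : 0 < ρ₀) (h : ℝ → ℝ) (hrad : IsRadialOutside W H ρ₀ h)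
    (hbdd : BddBelow ((fun r : ℝ => r * derivWithin h (Ici ρ₀) r - h r) '' Ici ρ₀))
    (hcontact : IsContactTypeOutside W J ρ₀)
    (ρ₁ : ℝ) (hρ₁ : ρ₀ ≤ ρ₁) (hxρ : ∀ t, radialVariable W (x t) < ρ₁) :
    IsCompact {z : CotangentBundle n M | radialVariable W z ≤ ρ₁} ∧
      ∀ u ∈ reducedUnstableManifold H J x, ∀ s ≤ (0 : ℝ), ∀ t : ℝ,
        radialVariable W (u (s, t)) ≤ ρ₁ := by
  refine ⟨hW.isCompact_radialVariable_le (hρ₀.trans_le hρ₁), ?_⟩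
  rintro u ⟨⟨hu, hper⟩, hF, -, hconv, hbd⟩
  have hlap := fun {s t : ℝ} (hs : s < 0) (hc : ρ₁ < radialVariable W (u (s, t))) =>
    laplacian_radialVariable_floer hW hρ₀ hrad hJω hcontact hu hF hs (hρ₁.trans_lt hc)
  refine le_of_neumann_maximum_principle (v := fun q => radialVariable W (u q))
    (β := fun r => r * derivWithin (derivWithin h (Ici ρ₀)) (Ici ρ₀) r)
    (hW.continuous_radialVariable.comp_continuousOn hu.continuousOn)
    (fun s hs t => congrArg _ (hper s hs t)) ?_ ?_ ?_
    (fun s hs t hc => (hlap hs hc).1) (fun s hs t hc => (hlap hs hc).2.1)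
    (fun s hs t hc => (hlap hs hc).2.2)
  -- The open set `ρ < ρ₁` contains the orbit, hence eventually the loops `u(s, ·)`.
  · exact hconv {q | radialVariable W q.2 < ρ₁}
      (isOpen_lt (hW.continuous_radialVariable.comp continuous_snd) continuous_const)
      fun t _ => hxρ t
  · exact continuousOn_id.mul
      (hrad.1.derivWithin_Ici.derivWithin_Ici.continuousOn.mono (Ici_subset_Ici.2 hρ₁))
  · intro t hc
    have hp : ((0 : ℝ), t) ∈ halfPlane := show (0 : ℝ) ≤ 0 from le_rfl
    obtain ⟨L, hL, hL1, -⟩ := radialVariable_floer_hasFDerivWithinAt hW hρ₀ hrad hJω hcontact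
      hu hF hp (hρ₁.trans_lt hc)
    -- The boundary condition is tested on the covector `p` of `u(0, t)` itself. Both terms of `∂ₛ
    -- v` are then `v h'(v)` with opposite signs.
    rw [liouvilleForm_dT_boundary hu t, hbd t,
      fibreDeriv_radialHamiltonian hW hrad.1 (hrad.2 t) (hρ₁.trans_lt hc), neg_add_cancel] at hL1
    exact (HasFDerivWithinAt.comp_hasDerivWithinAt (f := fun σ : ℝ => (σ, t)) (s := Iic 0) (0 : ℝ)
      hL ((hasDerivAt_id' (0 : ℝ)).prodMk (hasDerivAt_const 0 t)).hasDerivWithinAt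
      fun σ hσ => hσ).congr_deriv hL1
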